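/- **The model.** Let $\mathbb Z_+=\{0,1,2,\dots\}$. For $\Lambda\subseteq\mathbb Z_+$ (an environment: the set of columns that are present) and $p\in[0,1]$, let $\mathbb P_p^\Lambda$ be the law of independent bond percolation on the square lattice $\mathbb Z_+^2$ in which a vertical edge $\langle (x,y),(x,y+1)\rangle$ with $x\notin\Lambda$ is open with probability $0$ and every other edge is open with probability $p$. For integers $a<b$ and $c'<d$ in $\mathbb Z_+$, the rectangle $R([a,b)\times[c',d))$ is the graph with vertex set $[a,b]\times[c',d]$ and with the edges $\langle(x,y),(x+1,y)\rangle$, $\langle(x,y),(x,y+1)\rangle$, $a\le x<b$, $c'\le y<d$. It is crossed horizontally (vertically) if some path of open edges of $R$ joins $\{a\}\times[c',d]$ to $\{b\}\times[c',d]$ (respectively $[a,b]\times\{c'\}$ to $[a,b]\times\{d\}$). **Scales.** For $\alpha,c>0$ put $A=A(\alpha,c)=\alpha e^{c^2/32}$, and let $L_0=\lfloor A\rfloor$, $L_k=\lfloor A^{k+1}\rfloor L_{k-1}$ for $k\ge 1$, and $I_i^k=[iL_k,(i+1)L_k)\cap\mathbb Z_+$. For $\beta\in(0,1)$ let $H_0=100$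 and $H_k=2\big\lceil e^{L_k^{1-\beta/(k+1)}}\big\rceil H_{k-1}$ for $k\ge1$. Let $H_{i,j}^k$ be the event that $R\big((I_i^k\cup I_{i+1}^k)\times[jH_k,(j+1)H_k)\big)$ is crossed horizontally and $V_{i,j}^k$ the event that $R\big(I_i^k\times[jH_k,(j+2)H_k)\big)$ is crossed vertically. **Good intervals.** Fix an initial scale $k_0\in\mathbb Z_+$. The interval $I_i^{k_0}$ is good if $\Lambda\cap I_i^{k_0}\neq\emptyset$, and bad otherwise. For $k>k_0$, $I_i^k$ is bad if among the $\lfloor A^{k+1}\rfloor$ intervals of scale $k-1$ that partition it there are two non-consecutive bad ones, and good otherwise. **Failure probabilities.** For $k\ge k_0$ and $i,j\in\mathbb Z_+$ let $$q_k(p;i,j)=\max\Big\{\sup_{\Lambda:\ I_i^k,\,I_{i+1}^k\text{ good}}\mathbb P_p^\Lambda\big((H_{i,j}^k)^c\big),\ \sup_{\Lambda:\ I_i^k\text{ good}}\mathbb P_p^\Lambda\big((V_{i,j}^k)^c\big)\Big\}.$$ By translation invariance this does not depend on $i,j$, and it is denoted by $q_k(p)$. **Proposition.** Let $c_o>8\sqrt{\log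 96}$. There are $\alpha_o\in(e^{-c_o^2/32},1)$ and $\mu_o\in(0,1)$ such that $$A(\alpha,c)^{\mu/2}>96\quad\text{for all }\alpha\in(\alpha_o,1),\ \mu\in(\mu_o,1),\ c\ge c_o .\qquad(*)$$ Moreover, let $\alpha_o\in(e^{-c_o^2/32},1)$ and $\mu_o\in(0,1)$ be any numbers with property $(*)$, and let $\alpha\in(\alpha_o,1)$, $\mu\in(\mu_o,1)$ and $\mu<\beta<1$. Then for every initial scale $k_0\in\mathbb Z_+$ there is an integer $k_3\ge k_0$, not depending on $c$, such that for every $c\ge c_o$ there is $p_0=p_0(c)\in[0,1)$ with the following property: for all $k\ge k_3$, all $p\in[p_0,1]$ and all $i,j\in\mathbb Z_+$, $$q_k(p;i,j)\le \exp\Big(-L_k^{\,1-\frac{\mu}{k+1}}\Big).$$ Here the scales $L_k$, the heights $H_k$ and $q_k$ are those built from $A=A(\alpha,c)$, $\beta$ and $k_0$. -/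

import Mathlib

open MeasureTheory ProbabilityTheory Set
open scoped unitInterval ENNReal

namespace Stretched

noncomputable section

/-! ### Scales and heights -/

/-- The growth parameter `A(α, c) = α e^{c² / 32}`. -/
def growth (α c : ℝ) : ℝ := α * Real.exp (c ^ 2 / 32)

/-- The scales: `L₀ = ⌊A⌋` and `L_k = ⌊A^{k+1}⌋ L_{k-1}`. -/
def scale (A : ℝ) : ℕ → ℕ
  | 0 => ⌊A⌋₊
  | k + 1 => ⌊A ^ (k + 2)⌋₊ * scale A k

/-- The heights: `H₀ = 100` and `H_k = 2 ⌈exp (L_k^{1 - β/(k+1)})⌉ H_{k-1}`. -/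
def height (A β : ℝ) : ℕ → ℕ
  | 0 => 100
  | k + 1 =>
      2 * ⌈Real.exp ((scale A (k + 1) : ℝ) ^ (1 - β / ((k : ℝ) + 2)))⌉₊ * height A β k

/-- `(α₀, μ₀)` are thresholds for `c₀`: they lie in `(e^{-c₀²/32}, 1) × (0, 1)`, and
`A(α, c)^{μ/2} > 96` for all `α ∈ (α₀, 1)`, `μ ∈ (μ₀, 1)` and `c ≥ c₀`. -/
def IsThreshold (c₀ α₀ μ₀ : ℝ) : Prop :=
  Real.exp (-c₀ ^ 2 / 32) < α₀ ∧ α₀ < 1 ∧ 0 < μ₀ ∧ μ₀ < 1 ∧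
    ∀ α μ c : ℝ, α₀ < α → α < 1 → μ₀ < μ → μ < 1 → c₀ ≤ c → 96 < growth α c ^ (μ / 2)

/-! ### Environments: good and bad intervals -/

/-- The interval `I_i^k = [i L_k, (i+1) L_k)` of `ℕ`. -/
def block (A : ℝ) (k i : ℕ) : Set ℕ := Ico (i * scale A k) ((i + 1) * scale A k)

/-- The indices of the intervals of scale `k` that make up `I_i^{k+1}`. -/
def children (A : ℝ) (k i : ℕ) : Set ℕ := Ico (i * ⌊A ^ (k + 2)⌋₊) ((i + 1) * ⌊A ^ (k + 2)⌋₊)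

/-- `IsGood A k₀ Λ k i`: the interval `I_i^k` is good in the environment `Λ` (the set of
columns that are present), where `k₀` is the scale at which the labelling starts. At scale `k₀`
an interval is good if it meets `Λ`. At a scale `k > k₀` it is bad if it contains two bad
intervals of scale `k - 1` that are not consecutive, and good otherwise. (Below scale `k₀`,
where labels play no role, the rule of scale `k₀` is used.) -/
def IsGood (A : ℝ) (k₀ : ℕ) (Λ : Set ℕ) : ℕ → ℕ → Prop
  | 0, i => (Λ ∩ block A 0 i).Nonempty
  | k + 1, i =>
      if k + 1 ≤ k₀ then (Λ ∩ block A (k + 1) i).Nonempty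
      else ¬ ∃ a ∈ children A k i, ∃ b ∈ children A k i,
        a + 1 < b ∧ ¬ IsGood A k₀ Λ k a ∧ ¬ IsGood A k₀ Λ k b

/-! ### The percolation model on `ℕ²` -/

/-- Edges of the quadrant `ℕ²`: the edge `((x, y), true)` is horizontal and joins `(x, y)` to
`(x + 1, y)`, and the edge `((x, y), false)` is vertical and joins `(x, y)` to `(x, y + 1)`. -/
abbrev Edge : Type := (ℕ × ℕ) × Bool

/-- The upper or right end of an edge; the other end is `e.1`. -/
def Edge.tip (e : Edge) : ℕ × ℕ := if e.2 then (e.1.1 + 1, e.1.2) else (e.1.1, e.1.2 + 1)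

/-- Configurations; `ω e = true` means that the edge `e` is open. -/
abbrev Config : Type := Edge → Bool

open scoped Classical in
/-- The probability that an edge is open: `0` for vertical edges in a column outside `Λ`, and
`p` for all other edges. -/
def edgeProb (p : I) (Λ : Set ℕ) (e : Edge) : I :=
  if e.2 = false ∧ e.1.1 ∉ Λ then 0 else p

/-- The quenched law `P_p^Λ`: edges are open independently, with probabilities `edgeProb p Λ`. -/
def law (p : I) (Λ : Set ℕ) : Measure Config :=
  Measure.infinitePi fun e : Edge => bernoulliMeasure true false (edgeProb p Λ e)

/-! ### Crossings of rectangles -/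

/-- The edges of the rectangle `R([a, b) × [c, d))`: those of `[a, b] × [c, d]` except the ones
in its top and right sides. -/
def rectEdges (a b c d : ℕ) : Set Edge := {e | e.1.1 ∈ Ico a b ∧ e.1.2 ∈ Ico c d}

/-- The graph of the open edges of the rectangle `R([a, b) × [c, d))`. -/
def openGraph (a b c d : ℕ) (ω : Config) : SimpleGraph (ℕ × ℕ) :=
  SimpleGraph.fromEdgeSet {s | ∃ e ∈ rectEdges a b c d, ω e = true ∧ s = s(e.1, e.tip)}

/-- The event that `R([a, b) × [c, d))` is crossed horizontally by an open path. -/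
def crossH (a b c d : ℕ) : Set Config :=
  {ω | ∃ y ∈ Icc c d, ∃ y' ∈ Icc c d, (openGraph a b c d ω).Reachable (a, y) (b, y')}

/-- The event that `R([a, b) × [c, d))` is crossed vertically by an open path. -/
def crossV (a b c d : ℕ) : Set Config :=
  {ω | ∃ x ∈ Icc a b, ∃ x' ∈ Icc a b, (openGraph a b c d ω).Reachable (x, c) (x', d)}

/-- The event `H_{i,j}^k`: a horizontal crossing of `(I_i^k ∪ I_{i+1}^k) × [j H_k, (j+1) H_k)`. -/
def eventH (A β : ℝ) (k i j : ℕ) : Set Config :=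
  crossH (i * scale A k) ((i + 2) * scale A k) (j * height A β k) ((j + 1) * height A β k)

/-- The event `V_{i,j}^k`: a vertical crossing of `I_i^k × [j H_k, (j+2) H_k)`. -/
def eventV (A β : ℝ) (k i j : ℕ) : Set Config :=
  crossV (i * scale A k) ((i + 1) * scale A k) (j * height A β k) ((j + 2) * height A β k)

/-- `h_k(p; i, j)`: the worst probability that `H_{i,j}^k` fails, over all environments in which
`I_i^k` and `I_{i+1}^k` are good. -/
def hProb (A β : ℝ) (k₀ k i j : ℕ) (p : I) : ℝ≥0∞ :=
  ⨆ Λ ∈ {Λ : Set ℕ | IsGood A k₀ Λ k i ∧ IsGood A k₀ Λ k (i + 1)}, law p Λ (eventH A β k i j)ᶜ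

/-- `v_k(p; i, j)`: the worst probability that `V_{i,j}^k` fails, over all environments in which
`I_i^k` is good. -/
def vProb (A β : ℝ) (k₀ k i j : ℕ) (p : I) : ℝ≥0∞ :=
  ⨆ Λ ∈ {Λ : Set ℕ | IsGood A k₀ Λ k i}, law p Λ (eventV A β k i j)ᶜ

/-- `q_k(p; i, j) = max {h_k(p; i, j), v_k(p; i, j)}`. -/
def qProb (A β : ℝ) (k₀ k i j : ℕ) (p : I) : ℝ≥0∞ :=
  max (hProb A β k₀ k i j p) (vProb A β k₀ k i j p)

end

end Stretched

/-!
The bound is propagated from each scale to the next by a renormalization argument, which takes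
`k₃ = k₀ + 1` and needs of the growth parameter `A` only that `A ^ (μ / 2) ≥ 96`, hence
`A > 96 ^ 2`. The percolation parameter enters through `p₀`, which is chosen such that the bound
holds at scale `k₃` (`exists_crossingBound`) and that `p₀ ≥ exp (-1 / 12)`.

For the induction step (`CrossingBound.succ`), let `L` and `H` be the width and the height of the
blocks of scale `k`, let `W` be the number of blocks in an interval of scale `k + 1`, and let
`exp (-Q)` and `exp (-T)` be the bounds at the two scales. A good interval of scale `k + 1` has at
most two bad children, which are adjacent. Horizontal and vertical block crossings that overlap
meet (`exists_common_vertex`), so that they can be glued.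

* Vertical crossings (`law_compl_crossV_le`). One end of the interval is a run of `2 n` good
  children, with `n` about `W / 4`. Divide the rows of blocks into windows of `2 n` rows. If every
  window has a fully open row of sites and any two successive windows have a common fully open
  column, then these rows and columns form a vertical crossing, and no duality is needed.
  Every second row, and every second column, is independent of the others, so a window fails with
  probability of order `exp (-n Q)`. The number of windows is at most of order `exp T`, and
  `n Q ≥ 6 T`, because passing to scale `k + 1` gains a factor `A ^ (μ / 2)` over the
  target exponent (`rpow_scale_succ_le`).
* Horizontal crossings (`law_compl_crossH_le`). The strip of height `H_{k+1}` contains a number of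
  order `exp (L_{k+1} ^ (1 - β / (k + 2)))` of independent thinner strips. In each of them, with
  probability at least `1 / 2`, the good children are linked by block crossings, and the
  at most four bad ones are bridged by straight segments at the top of the vertical block crossings.
  The segments have at most `12 L` edges, disjoint from those of the block crossings, and are open
  with probability at least `exp (-L)`. Since `L` is at most half of
  `L_{k+1} ^ (1 - β / (k + 2))`, one of the strips succeeds except with a doubly exponentially
  small probability (`horizontal_estimate`).
-/

namespace Stretched

noncomputable section

/-! ### Crossing lattice paths meet -/

/-- `u` and `v` are neighbours in the square lattice. -/
def LatticeAdj (u v : ℕ × ℕ) : Prop :=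
  (u.2 = v.2 ∧ (u.1 + 1 = v.1 ∨ v.1 + 1 = u.1)) ∨ (u.1 = v.1 ∧ (u.2 + 1 = v.2 ∨ v.2 + 1 = u.2))

/-- The signed number of times that the path `f 0, …, f n` crosses the horizontal ray that leaves
`v + (0, 1/2)` to the left, where the path is thought of as continued vertically upwards from
`f n`. -/
def leftCrossings (f : ℕ → ℕ × ℕ) (n : ℕ) (v : ℕ × ℕ) : ℤ :=
  ∑ t ∈ Finset.range n, (if (f t).1 < v.1 then
      ((if v.2 < (f (t + 1)).2 then 1 else 0) - (if v.2 < (f t).2 then 1 else 0) : ℤ) else 0)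
    + if (f n).1 < v.1 ∧ (f n).2 ≤ v.2 then 1 else 0

lemma leftCrossings_right {f : ℕ → ℕ × ℕ} {n x y : ℕ}
    (hf : ∀ t < n, LatticeAdj (f t) (f (t + 1))) (hav : ∀ t ≤ n, f t ≠ (x, y))
    (hn : y ≤ (f n).2) : leftCrossings f n (x + 1, y) = leftCrossings f n (x, y) := by
  unfold leftCrossings
  congr 1
  · refine Finset.sum_congr rfl fun t ht => ?_
    have ht := Finset.mem_range.1 ht
    have h := hf t ht
    have h1 := hav t ht.le
    have h2 := hav (t + 1) ht
    simp only [LatticeAdj, ne_eq, Prod.ext_iff, not_and] at h h1 h2 ⊢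
    grind
  · have h := hav n le_rfl
    simp only [ne_eq, Prod.ext_iff, not_and] at h ⊢
    grind

lemma leftCrossings_up {f : ℕ → ℕ × ℕ} {n x y : ℕ}
    (hf : ∀ t < n, LatticeAdj (f t) (f (t + 1))) (hav : ∀ t ≤ n, f t ≠ (x, y + 1))
    (h0 : (f 0).2 ≤ y) : leftCrossings f n (x, y + 1) = leftCrossings f n (x, y) := by
  -- The difference of the two sums telescopes to the boundary terms of the indicator `g`.
  set g : ℕ × ℕ → ℤ := fun u => if u.1 < x ∧ u.2 = y + 1 then 1 else 0 with hg
  have key : ∑ t ∈ Finset.range n, (if (f t).1 < x then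
      ((if y < (f (t + 1)).2 then 1 else 0) - (if y < (f t).2 then 1 else 0) : ℤ) else 0)
      - ∑ t ∈ Finset.range n, (if (f t).1 < x then
      ((if y + 1 < (f (t + 1)).2 then 1 else 0) - (if y + 1 < (f t).2 then 1 else 0) : ℤ) else 0)
      = g (f n) - g (f 0) := by
    rw [← Finset.sum_range_sub (fun t => g (f t)), ← Finset.sum_sub_distrib]
    refine Finset.sum_congr rfl fun t ht => ?_
    have ht := Finset.mem_range.1 ht
    have h := hf t ht
    have h1 := hav t ht.le
    have h2 := hav (t + 1) ht
    simp only [hg, LatticeAdj, ne_eq, Prod.ext_iff, not_and] at h h1 h2 ⊢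
    grind
  have hg0 : g (f 0) = 0 := by simp only [hg]; grind
  have hgn : g (f n) = (if (f n).1 < x ∧ (f n).2 ≤ y + 1 then (1 : ℤ) else 0)
      - if (f n).1 < x ∧ (f n).2 ≤ y then 1 else 0 := by simp only [hg]; grind
  simp only [leftCrossings]
  linarith

lemma leftCrossings_eq_zero {f : ℕ → ℕ × ℕ} {n x y : ℕ} (h : ∀ t ≤ n, x ≤ (f t).1) :
    leftCrossings f n (x, y) = 0 := by
  unfold leftCrossings
  rw [Finset.sum_eq_zero, if_neg]
  · rfl
  · have := h n le_rfl
    grind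
  · intro t ht
    have := h t (Finset.mem_range.1 ht).le
    exact if_neg (by simpa using this)

lemma leftCrossings_eq_one {f : ℕ → ℕ × ℕ} {n x y : ℕ}
    (hf : ∀ t < n, LatticeAdj (f t) (f (t + 1))) (hav : ∀ t ≤ n, f t ≠ (x, y))
    (h : ∀ t ≤ n, (f t).1 ≤ x) (h0 : (f 0).2 ≤ y) (hn : y ≤ (f n).2) :
    leftCrossings f n (x, y) = 1 := by
  rw [← leftCrossings_right hf hav hn]
  have : ∑ t ∈ Finset.range n, (if (f t).1 < x + 1 then
      ((if y < (f (t + 1)).2 then 1 else 0) - (if y < (f t).2 then 1 else 0) : ℤ) else 0)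
      = (if y < (f n).2 then 1 else 0) - (if y < (f 0).2 then 1 else 0) := by
    rw [← Finset.sum_range_sub (fun t => if y < (f t).2 then (1 : ℤ) else 0)]
    refine Finset.sum_congr rfl fun t ht => ?_
    have := h t (Finset.mem_range.1 ht).le
    exact if_pos (by omega)
  simp only [leftCrossings]
  rw [this]
  have := h n le_rfl
  grind

/-- A path from the left side to the right side of `[a, b] × [c, d]` meets every path from height
`c' ≤ c` to height `d' ≥ d` in the strip `[a, b] × ℕ`: otherwise the number of crossings of the
leftward ray with the second path would be constant along the first one, while it is `0` at
its left end and `1` at its right end. -/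
theorem exists_common_vertex {G₁ G₂ : SimpleGraph (ℕ × ℕ)} {a b c d c' d' y y' x x' : ℕ}
    (h₁ : ∀ u v, G₁.Adj u v → LatticeAdj u v ∧ v.2 ∈ Icc c d)
    (h₂ : ∀ u v, G₂.Adj u v → LatticeAdj u v ∧ v.1 ∈ Icc a b)
    (hy : y ∈ Icc c d) (hx : x ∈ Icc a b) (hc : c' ≤ c) (hd : d ≤ d')
    (r₁ : G₁.Reachable (a, y) (b, y')) (r₂ : G₂.Reachable (x, c') (x', d')) :
    ∃ z, G₁.Reachable (a, y) z ∧ G₂.Reachable (x, c') z := by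
  by_contra! hcon
  obtain ⟨Q⟩ := r₂
  obtain ⟨P⟩ := r₁
  set f := Q.getVert with hfdef
  set n := Q.length
  have f0 : f 0 = (x, c') := Q.getVert_zero
  have fn : f n = (x', d') := Q.getVert_length
  have hf : ∀ t < n, LatticeAdj (f t) (f (t + 1)) := fun t ht =>
    (h₂ _ _ (Q.adj_getVert_succ ht)).1
  have hfx : ∀ t ≤ n, (f t).1 ∈ Icc a b := by
    intro t ht
    rcases t with _ | t
    · rw [f0]; exact hx
    · exact (h₂ _ _ (Q.adj_getVert_succ ht)).2
  have hfr : ∀ t, G₂.Reachable (x, c') (f t) := fun t => ⟨Q.take t⟩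
  have hav : ∀ z, G₁.Reachable (a, y) z → ∀ t ≤ n, f t ≠ z := by
    rintro z hz t - rfl
    exact hcon _ hz (hfr t)
  -- The crossing number is constant along the first path.
  have hconst : ∀ {u v : ℕ × ℕ} (R : G₁.Walk u v), G₁.Reachable (a, y) u → u.2 ∈ Icc c d →
      leftCrossings f n u = leftCrossings f n v := by
    intro u v R
    induction R with
    | nil => intros; rfl
    | @cons u w v huw R ih =>
      intro hu hud
      have hw := hu.trans huw.reachable
      obtain ⟨hl, hwd⟩ := h₁ _ _ huw
      rw [← ih hw hwd]
      obtain ⟨u1, u2⟩ := u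
      obtain ⟨w1, w2⟩ := w
      have hau := hav _ hu
      have haw := hav _ hw
      simp only [LatticeAdj, mem_Icc] at hl hud hwd
      rcases hl with ⟨rfl, rfl | rfl⟩ | ⟨rfl, rfl | rfl⟩
      · exact (leftCrossings_right hf hau (by rw [fn]; simp; omega)).symm
      · exact leftCrossings_right hf haw (by rw [fn]; simp; omega)
      · exact (leftCrossings_up hf haw (by rw [f0]; simp; omega)).symm
      · exact leftCrossings_up hf hau (by rw [f0]; simp; omega)
  have hy'cd : y' ∈ Icc c d := by
    have : ∀ {u v : ℕ × ℕ} (_ : G₁.Walk u v), u.2 ∈ Icc c d → v.2 ∈ Icc c d := by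
      intro u v R
      induction R with
      | nil => exact id
      | cons huw R ih => exact fun _ => ih (h₁ _ _ huw).2
    exact this P hy
  have e := hconst P (SimpleGraph.Reachable.refl _) hy
  rw [leftCrossings_eq_zero (fun t ht => (hfx t ht).1),
    leftCrossings_eq_one hf (hav _ ⟨P⟩) (fun t ht => (hfx t ht).2)
      (by rw [f0]; exact hc.trans hy'cd.1) (by rw [fn]; exact hy'cd.2.trans hd)] at e
  exact absurd e (by norm_num)

/-! ### Graphs of open edges -/

lemma openGraph_adj {a b c d : ℕ} {ω : Config} {u v : ℕ × ℕ} (h : (openGraph a b c d ω).Adj u v) :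
    LatticeAdj u v ∧ v.1 ∈ Icc a b ∧ v.2 ∈ Icc c d := by
  obtain ⟨⟨e, he, -, hs⟩, -⟩ := (SimpleGraph.fromEdgeSet_adj _).1 h
  obtain ⟨⟨e1, e2⟩, e3⟩ := e
  simp only [rectEdges, mem_ofPred_eq, mem_Ico] at he
  cases e3 <;> simp [Edge.tip] at hs <;>
    rcases hs with ⟨rfl, rfl⟩ | ⟨rfl, rfl⟩ <;> simp [LatticeAdj] <;> omega

lemma openGraph_adj_tip {a b c d : ℕ} {ω : Config} {e : Edge} (he : e ∈ rectEdges a b c d)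
    (ho : ω e = true) : (openGraph a b c d ω).Adj e.1 e.tip := by
  refine (SimpleGraph.fromEdgeSet_adj _).2 ⟨⟨e, he, ho, rfl⟩, ?_⟩
  rw [Edge.tip]
  split_ifs <;> simp [Prod.ext_iff]

lemma openGraph_mono {a b c d a' b' c' d' : ℕ} (ω : Config) (ha : a' ≤ a) (hb : b ≤ b')
    (hc : c' ≤ c) (hd : d ≤ d') : openGraph a b c d ω ≤ openGraph a' b' c' d' ω := by
  refine SimpleGraph.fromEdgeSet_mono ?_
  rintro s ⟨e, ⟨h1, h2⟩, ho, rfl⟩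
  exact ⟨e, ⟨⟨ha.trans h1.1, h1.2.trans_le hb⟩, ⟨hc.trans h2.1, h2.2.trans_le hd⟩⟩, ho, rfl⟩

/-- A horizontal crossing and a vertical crossing of overlapping rectangles are connected. -/
theorem reachable_of_crossings {a b c d a' b' c' d' y y' x x' : ℕ} {ω : Config}
    {G : SimpleGraph (ℕ × ℕ)} (ha : a ≤ a') (hb : b' ≤ b) (hc : c' ≤ c) (hd : d ≤ d')
    (hy : y ∈ Icc c d) (hx : x ∈ Icc a' b')
    (r₁ : (openGraph a b c d ω).Reachable (a, y) (b, y'))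
    (r₂ : (openGraph a' b' c' d' ω).Reachable (x, c') (x', d'))
    (h₁ : openGraph a b c d ω ≤ G) (h₂ : openGraph a' b' c' d' ω ≤ G) :
    G.Reachable (a, y) (x, c') := by
  obtain ⟨z, hz₁, hz₂⟩ := exists_common_vertex (a := a) (b := b)
    (fun u v h => ⟨(openGraph_adj h).1, (openGraph_adj h).2.2⟩)
    (fun u v h => ⟨(openGraph_adj h).1, Icc_subset_Icc ha hb (openGraph_adj h).2.1⟩)
    hy (Icc_subset_Icc ha hb hx) hc hd r₁ r₂
  exact (hz₁.mono h₁).trans (hz₂.mono h₂).symm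

/-- A horizontal segment whose edges are all open is connected. -/
lemma reachable_of_row_open {a b c d x x' y : ℕ} {ω : Config} (hx : a ≤ x) (hxx' : x ≤ x')
    (hx' : x' ≤ b) (hy : y ∈ Ico c d) (h : ∀ t ∈ Ico x x', ω ((t, y), true) = true) :
    (openGraph a b c d ω).Reachable (x, y) (x', y) := by
  induction x', hxx' using Nat.le_induction with
  | base => exact SimpleGraph.Reachable.refl _
  | succ t ht ih =>
    refine (ih (by omega) fun s hs => h s ⟨hs.1, by have := hs.2; omega⟩).trans ?_
    exact (openGraph_adj_tip (e := ((t, y), true)) ⟨⟨by simp; omega, by simp; omega⟩, hy⟩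
      (h t ⟨ht, by omega⟩)).reachable

/-- A vertical segment whose edges are all open is connected. -/
lemma reachable_of_column_open {a b c d x y y' : ℕ} {ω : Config} (hy : c ≤ y) (hyy' : y ≤ y')
    (hy' : y' ≤ d) (hx : x ∈ Ico a b) (h : ∀ t ∈ Ico y y', ω ((x, t), false) = true) :
    (openGraph a b c d ω).Reachable (x, y) (x, y') := by
  induction y', hyy' using Nat.le_induction with
  | base => exact SimpleGraph.Reachable.refl _
  | succ t ht ih =>
    refine (ih (by omega) fun s hs => h s ⟨hs.1, by have := hs.2; omega⟩).trans ?_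
    exact (openGraph_adj_tip (e := ((x, t), false)) ⟨hx, ⟨by simp; omega, by simp; omega⟩⟩
      (h t ⟨ht, by omega⟩)).reachable

/-! ### Local events and independence -/

instance (p : I) (Λ : Set ℕ) : IsProbabilityMeasure (law p Λ) := by
  unfold law; infer_instance

/-- The event `E` is determined by the states of the edges in the finite set `T`. -/
def IsLocal (E : Set Config) (T : Finset Edge) : Prop :=
  ∀ ω ω' : Config, (∀ e ∈ T, ω e = ω' e) → ω ∈ E → ω' ∈ E

lemma IsLocal.mono {E : Set Config} {S T : Finset Edge} (h : IsLocal E S) (hST : S ⊆ T) :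
    IsLocal E T := fun ω ω' hω => h ω ω' fun e he => hω e (hST he)

lemma IsLocal.compl {E : Set Config} {T : Finset Edge} (h : IsLocal E T) : IsLocal Eᶜ T :=
  fun ω ω' hω hE hE' => hE (h ω' ω (fun e he => (hω e he).symm) hE')

lemma IsLocal.inter {E F : Set Config} {T : Finset Edge} (hE : IsLocal E T) (hF : IsLocal F T) :
    IsLocal (E ∩ F) T := fun ω ω' hω h => ⟨hE ω ω' hω h.1, hF ω ω' hω h.2⟩

lemma IsLocal.iInter {ι : Sort*} {E : ι → Set Config} {T : Finset Edge}
    (h : ∀ i, IsLocal (E i) T) : IsLocal (⋂ i, E i) T := fun ω ω' hω hE =>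
  mem_iInter.2 fun i => h i ω ω' hω (mem_iInter.1 hE i)

lemma IsLocal.eq_preimage {E : Set Config} {T : Finset Edge} (h : IsLocal E T) :
    ∃ B : Set (T → Bool), MeasurableSet B ∧ E = (fun ω (e : T) => ω e) ⁻¹' B := by
  refine ⟨(fun ω (e : T) => ω e) '' E, (toFinite _).measurableSet, ?_⟩
  refine Subset.antisymm (subset_preimage_image _ _) ?_
  rintro ω ⟨ω', hω', he⟩
  exact h ω' ω (fun e heT => congrFun he ⟨e, heT⟩) hω'

lemma IsLocal.measurableSet {E : Set Config} {T : Finset Edge} (h : IsLocal E T) :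
    MeasurableSet E := by
  obtain ⟨B, hB, rfl⟩ := h.eq_preimage
  exact (by fun_prop : Measurable fun (ω : Config) (e : T) => ω e) hB

lemma iIndepFun_law (p : I) (Λ : Set ℕ) :
    iIndepFun (fun (e : Edge) (ω : Config) => ω e) (law p Λ) :=
  iIndepFun_infinitePi (X := fun _ => id) (fun _ => measurable_id)

lemma law_inter_of_isLocal (p : I) (Λ : Set ℕ) {E F : Set Config} {S T : Finset Edge}
    (hE : IsLocal E S) (hF : IsLocal F T) (hST : Disjoint S T) :
    (law p Λ).real (E ∩ F) = (law p Λ).real E * (law p Λ).real F := by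
  obtain ⟨B, hB, rfl⟩ := hE.eq_preimage
  obtain ⟨C, hC, rfl⟩ := hF.eq_preimage
  have := ((iIndepFun_law p Λ).indepFun_finset S T hST
    (fun e => measurable_pi_apply e)).measure_inter_preimage_eq_mul _ _ hB hC
  simp only [measureReal_def, this, ENNReal.toReal_mul]

/-- Independent trials: if the events `E t` live on disjoint sets of edges and each has
probability at most `r`, then `n` of them occur simultaneously with probability at most `r ^ n`. -/
lemma law_iInter_le_pow (p : I) (Λ : Set ℕ) {E : ℕ → Set Config} {T : ℕ → Finset Edge} {r : ℝ}
    (hE : ∀ t, IsLocal (E t) (T t)) (hT : Pairwise fun s t => Disjoint (T s) (T t)) (n : ℕ)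
    (hr : ∀ t < n, (law p Λ).real (E t) ≤ r) :
    (law p Λ).real (⋂ t ∈ Finset.range n, E t) ≤ r ^ n := by
  induction n with
  | zero => simp
  | succ n ih =>
    have hr0 : 0 ≤ r := measureReal_nonneg.trans (hr n n.lt_succ_self)
    have hloc : IsLocal (⋂ t ∈ Finset.range n, E t) ((Finset.range n).biUnion T) :=
      IsLocal.iInter fun t => IsLocal.iInter fun ht =>
        (hE t).mono (Finset.subset_biUnion_of_mem T ht)
    have hdis : Disjoint ((Finset.range n).biUnion T) (T n) := by
      rw [Finset.disjoint_biUnion_left]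
      exact fun t ht => hT (Finset.mem_range.1 ht).ne
    have heq : (⋂ t ∈ Finset.range (n + 1), E t) = (⋂ t ∈ Finset.range n, E t) ∩ E n := by
      ext ω
      simp [Nat.le_iff_lt_or_eq, or_imp, forall_and]
    rw [heq, law_inter_of_isLocal p Λ hloc (hE n) hdis, pow_succ]
    exact mul_le_mul (ih fun t ht => hr t (by omega)) (hr n n.lt_succ_self) measureReal_nonneg
      (pow_nonneg hr0 n)

lemma law_edge_open (p : I) (Λ : Set ℕ) (e : Edge) :
    (law p Λ).real {ω | ω e = true} = edgeProb p Λ e := by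
  have h := measurePreserving_eval_infinitePi
    (fun e : Edge => bernoulliMeasure true false (edgeProb p Λ e)) e
  have h1 := h.measureReal_preimage (s := {true}) (by measurability)
  have h2 : (law p Λ).real {ω | ω e = true} =
      (bernoulliMeasure true false (edgeProb p Λ e)).real {true} := h1
  rw [h2, bernoulliMeasure_real_apply_of_mem_of_notMem _ (by simp) (by simp) (by measurability)]

lemma isLocal_edge_open (e : Edge) : IsLocal {ω | ω e = true} {e} := fun ω ω' h hω => by
  have := h e (Finset.mem_singleton_self e)
  simp_all

lemma isLocal_all_open (S : Finset Edge) : IsLocal {ω | ∀ e ∈ S, ω e = true} S :=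
  fun _ _ h hω e he => (h e he) ▸ hω e he

lemma law_all_open (p : I) (Λ : Set ℕ) {S : Finset Edge} (hS : ∀ e ∈ S, edgeProb p Λ e = p) :
    (law p Λ).real {ω | ∀ e ∈ S, ω e = true} = (p : ℝ) ^ S.card := by
  induction S using Finset.induction_on with
  | empty => simp
  | insert e S he ih =>
    have heq : {ω : Config | ∀ e' ∈ insert e S, ω e' = true}
        = {ω | ω e = true} ∩ {ω | ∀ e' ∈ S, ω e' = true} := by
      ext ω; simp
    rw [heq, law_inter_of_isLocal p Λ (isLocal_edge_open e) (isLocal_all_open S)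
      (Finset.disjoint_singleton_left.2 he), law_edge_open,
      ih fun e' he' => hS e' (Finset.mem_insert_of_mem he'), Finset.card_insert_of_notMem he,
      hS e (Finset.mem_insert_self e S), pow_succ']

/-- The edges of the rectangle `R([a, b) × [c, d))`, as a finite set. -/
def rectFinset (a b c d : ℕ) : Finset Edge :=
  (Finset.Ico a b ×ˢ Finset.Ico c d) ×ˢ Finset.univ

lemma mem_rectFinset {a b c d : ℕ} {e : Edge} :
    e ∈ rectFinset a b c d ↔ (a ≤ e.1.1 ∧ e.1.1 < b) ∧ c ≤ e.1.2 ∧ e.1.2 < d := by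
  simp [rectFinset]

lemma openGraph_congr {a b c d : ℕ} {ω ω' : Config}
    (h : ∀ e ∈ rectFinset a b c d, ω e = ω' e) :
    openGraph a b c d ω = openGraph a b c d ω' := by
  unfold openGraph
  congr 1
  ext s
  constructor <;> rintro ⟨e, he, ho, rfl⟩
  · exact ⟨e, he, (h e (mem_rectFinset.2 he)) ▸ ho, rfl⟩
  · exact ⟨e, he, (h e (mem_rectFinset.2 he)).symm ▸ ho, rfl⟩

lemma isLocal_crossH (a b c d : ℕ) : IsLocal (crossH a b c d) (rectFinset a b c d) := by
  rintro ω ω' h ⟨y, hy, y', hy', hr⟩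
  exact ⟨y, hy, y', hy', openGraph_congr h ▸ hr⟩

lemma isLocal_crossV (a b c d : ℕ) : IsLocal (crossV a b c d) (rectFinset a b c d) := by
  rintro ω ω' h ⟨x, hx, x', hx', hr⟩
  exact ⟨x, hx, x', hx', openGraph_congr h ▸ hr⟩

lemma rectFinset_mono {a b c d a' b' c' d' : ℕ} (ha : a' ≤ a) (hb : b ≤ b')
    (hc : c' ≤ c) (hd : d ≤ d') : rectFinset a b c d ⊆ rectFinset a' b' c' d' := by
  intro e he
  rw [mem_rectFinset] at he ⊢
  omega

lemma disjoint_rectFinset_of_le_left {a b c d a' b' c' d' : ℕ} (h : b ≤ a') :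
    Disjoint (rectFinset a b c d) (rectFinset a' b' c' d') := by
  rw [Finset.disjoint_left]
  intro e he he'
  rw [mem_rectFinset] at he he'
  omega

lemma disjoint_rectFinset_of_le_bottom {a b c d a' b' c' d' : ℕ} (h : d ≤ c') :
    Disjoint (rectFinset a b c d) (rectFinset a' b' c' d') := by
  rw [Finset.disjoint_left]
  intro e he he'
  rw [mem_rectFinset] at he he'
  omega

/-- Union bound: the probability that some edge of `S` is closed, if no edge of `S` is absent. -/
lemma law_exists_closed_le (p : I) (Λ : Set ℕ) {S : Finset Edge}
    (hS : ∀ e ∈ S, edgeProb p Λ e = p) :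
    (law p Λ).real {ω | ∀ e ∈ S, ω e = true}ᶜ ≤ S.card * (1 - (p : ℝ)) := by
  rw [measureReal_compl (isLocal_all_open S).measurableSet, law_all_open p Λ hS]
  have := one_add_mul_le_pow (a := (p : ℝ) - 1) (by linarith [p.2.1]) S.card
  simp only [probReal_univ]
  rw [add_sub_cancel] at this
  linarith

/-! ### Renormalized sites -/

/-- The horizontal crossing event of two adjacent blocks of width `L` and height `H`. -/
def blockH (L H i j : ℕ) : Set Config := crossH (i * L) ((i + 2) * L) (j * H) ((j + 1) * H)

/-- The vertical crossing event of two stacked blocks of width `L` and height `H`. -/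
def blockV (L H i j : ℕ) : Set Config := crossV (i * L) ((i + 1) * L) (j * H) ((j + 2) * H)

/-- The event that the renormalized site `(i, j)` is open. -/
def site (L H i j : ℕ) : Set Config := blockH L H i j ∩ blockV L H i j

lemma isLocal_blockH (L H i j : ℕ) : IsLocal (blockH L H i j)
    (rectFinset (i * L) ((i + 2) * L) (j * H) ((j + 2) * H)) :=
  (isLocal_crossH _ _ _ _).mono (rectFinset_mono le_rfl le_rfl le_rfl
    (Nat.mul_le_mul_right _ (by omega)))

lemma isLocal_blockV (L H i j : ℕ) : IsLocal (blockV L H i j)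
    (rectFinset (i * L) ((i + 2) * L) (j * H) ((j + 2) * H)) :=
  (isLocal_crossV _ _ _ _).mono (rectFinset_mono le_rfl (Nat.mul_le_mul_right _ (by omega))
    le_rfl le_rfl)

lemma isLocal_site (L H i j : ℕ) : IsLocal (site L H i j)
    (rectFinset (i * L) ((i + 2) * L) (j * H) ((j + 2) * H)) :=
  (isLocal_blockH L H i j).inter (isLocal_blockV L H i j)

lemma law_compl_biInter_le (p : I) (Λ : Set ℕ) {F : ℕ → Set Config} {w : ℕ} {r : ℝ}
    (h : ∀ i < w, (law p Λ).real (F i)ᶜ ≤ r) :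
    (law p Λ).real (⋂ i ∈ Finset.range w, F i)ᶜ ≤ w * r := by
  simp only [compl_iInter]
  refine (measureReal_biUnion_finset_le _ _).trans ?_
  refine (Finset.sum_le_card_nsmul _ _ r fun i hi => h i (Finset.mem_range.1 hi)).trans ?_
  simp

lemma law_compl_inter_le (p : I) (Λ : Set ℕ) {E F : Set Config} {q : ℝ}
    (hE : (law p Λ).real Eᶜ ≤ q) (hF : (law p Λ).real Fᶜ ≤ q) :
    (law p Λ).real (E ∩ F)ᶜ ≤ 2 * q := by
  rw [compl_inter]
  linarith [measureReal_union_le (μ := law p Λ) Eᶜ Fᶜ]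

/-! ### Vertical crossings of renormalized rectangles -/

/-- In a strip of sites, an open row in every window of `M` rows and a column that is open along
every two successive windows make up a connected structure that spans the strip. The predicate
`C` stands for being connected to the bottom. -/
lemma exists_connected_top {C O : ℕ → ℕ → Prop} {i₀ w M N : ℕ} (hM : 0 < M)
    (hrow : ∀ i t, i₀ ≤ i → i + 1 < i₀ + w → t ≤ N → O i t → O (i + 1) t → (C i t ↔ C (i + 1) t))
    (hcol : ∀ i t, i₀ ≤ i → i < i₀ + w → t + 1 ≤ N → O i t → O i (t + 1) →
      (C i t ↔ C i (t + 1)))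
    (hbot : ∀ i, i₀ ≤ i → i < i₀ + w → O i 0 → C i 0)
    (hR : ∀ s, s * M ≤ N → ∃ r, s * M ≤ r ∧ r < (s + 1) * M ∧ ∀ i, i₀ ≤ i → i < i₀ + w → O i r)
    (hS : ∀ s, s * M ≤ N → ∃ i, i₀ ≤ i ∧ i < i₀ + w ∧
      ∀ t, s * M ≤ t → t < (s + 2) * M → O i t) :
    ∃ i, i₀ ≤ i ∧ i < i₀ + w ∧ O i N ∧ C i N := by
  have hrow' : ∀ t, t ≤ N → (∀ i, i₀ ≤ i → i < i₀ + w → O i t) →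
      ∀ u, i₀ + u < i₀ + w → (C i₀ t ↔ C (i₀ + u) t) := by
    intro t ht hO u
    induction u with
    | zero => intro _; rfl
    | succ u ih =>
      intro hu
      exact (ih (by omega)).trans (hrow (i₀ + u) t (by omega) (by omega) ht
        (hO _ (by omega) (by omega)) (hO _ (by omega) (by omega)))
  have hcol' : ∀ i t, i₀ ≤ i → i < i₀ + w → ∀ u, t + u ≤ N →
      (∀ v ≤ u, O i (t + v)) → (C i t ↔ C i (t + u)) := by
    intro i t hi hi' u
    induction u with
    | zero => intros; rfl
    | succ u ih =>
      intro hu hO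
      exact (ih (by omega) fun v hv => hO v (by omega)).trans
        (hcol i (t + u) hi hi' (by omega) (hO u (by omega)) (hO (u + 1) le_rfl))
  have hcol'' : ∀ i, i₀ ≤ i → i < i₀ + w → ∀ t t', t ≤ t' → t' ≤ N →
      (∀ v, t ≤ v → v ≤ t' → O i v) → (C i t ↔ C i t') := by
    intro i hi hi' t t' htt' ht' hO
    obtain ⟨u, rfl⟩ := Nat.exists_eq_add_of_le htt'
    exact hcol' i t hi hi' u ht' fun v hv => hO _ (by omega) (by omega)
  have main : ∀ s, s * M ≤ N → ∃ i, i₀ ≤ i ∧ i < i₀ + w ∧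
      ∀ t, s * M ≤ t → t < (s + 2) * M → t ≤ N → O i t ∧ C i t := by
    intro s
    induction s with
    | zero =>
      intro h
      obtain ⟨i, hi, hi', hO⟩ := hS 0 h
      refine ⟨i, hi, hi', fun t ht ht' htN => ⟨hO t ht ht', ?_⟩⟩
      refine (hcol'' i hi hi' 0 t (by omega) htN fun v _ hv => hO v (by omega) (by omega)).1 ?_
      exact hbot i hi hi' (hO 0 (by omega) (by omega))
    | succ s ih =>
      intro h
      have e1 : (s + 1) * M = s * M + M := by ring
      have e2 : (s + 2) * M = s * M + 2 * M := by ring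
      have e3 : (s + 1 + 1) * M = s * M + 2 * M := by ring
      have e4 : (s + 1 + 2) * M = s * M + 3 * M := by ring
      obtain ⟨i, hi, hi', hC⟩ := ih (by omega)
      obtain ⟨r, hr, hr', hrO⟩ := hR (s + 1) h
      by_cases hrN : r ≤ N
      · obtain ⟨i', hi1, hi2, hO⟩ := hS (s + 1) h
        refine ⟨i', hi1, hi2, fun t ht ht' htN => ⟨hO t ht ht', ?_⟩⟩
        obtain ⟨u, rfl⟩ := Nat.exists_eq_add_of_le hi
        obtain ⟨u', rfl⟩ := Nat.exists_eq_add_of_le hi1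
        have h1 : C (i₀ + u') r := (hrow' r hrN hrO u' hi2).1
          ((hrow' r hrN hrO u hi').2 (hC r (by omega) (by omega) hrN).2)
        rcases le_total r t with hrt | hrt
        · exact (hcol'' _ hi1 hi2 r t hrt htN fun v hv hv' => hO v (by omega) (by omega)).1 h1
        · exact (hcol'' _ hi1 hi2 t r hrt hrN fun v hv hv' => hO v (by omega) (by omega)).2 h1
      · exact ⟨i, hi, hi', fun t ht ht' htN => hC t (by omega) (by omega) htN⟩
  obtain ⟨i, hi, hi', h⟩ := main (N / M) (Nat.div_mul_le_self N M)
  have hlt : N < (N / M + 2) * M := by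
    have := Nat.lt_div_mul_add (a := N) hM
    nlinarith
  exact ⟨i, hi, hi', h N (Nat.div_mul_le_self N M) hlt le_rfl⟩

/-- Two horizontal block crossings that meet a common vertical block crossing are connected. -/
lemma reachable_left_ends {L H i i' j j' k l y y' z z' : ℕ} {ω : Config}
    {G : SimpleGraph (ℕ × ℕ)} (hV : ω ∈ blockV L H k l)
    (hVG : openGraph (k * L) ((k + 1) * L) (l * H) ((l + 2) * H) ω ≤ G)
    (hi : i ≤ k ∧ k ≤ i + 1) (hi' : i' ≤ k ∧ k ≤ i' + 1) (hj : l ≤ j ∧ j ≤ l + 1)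
    (hj' : l ≤ j' ∧ j' ≤ l + 1) (hy : y ∈ Icc (j * H) ((j + 1) * H))
    (hz : z ∈ Icc (j' * H) ((j' + 1) * H))
    (r : (openGraph (i * L) ((i + 2) * L) (j * H) ((j + 1) * H) ω).Reachable
      (i * L, y) ((i + 2) * L, y'))
    (r' : (openGraph (i' * L) ((i' + 2) * L) (j' * H) ((j' + 1) * H) ω).Reachable
      (i' * L, z) ((i' + 2) * L, z'))
    (hG : openGraph (i * L) ((i + 2) * L) (j * H) ((j + 1) * H) ω ≤ G)
    (hG' : openGraph (i' * L) ((i' + 2) * L) (j' * H) ((j' + 1) * H) ω ≤ G) :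
    G.Reachable (i * L, y) (i' * L, z) := by
  obtain ⟨x, hx, x', hx', rV⟩ := hV
  refine (reachable_of_crossings ?_ ?_ ?_ ?_ hy hx r rV hG hVG).trans
    (reachable_of_crossings ?_ ?_ ?_ ?_ hz hx r' rV hG' hVG).symm <;>
    exact Nat.mul_le_mul_right _ (by omega)

/-- A rectangle of blocks is crossed vertically if every window of `M` rows of sites contains an
open row, and every two successive windows contain a common open column. -/
theorem mem_crossV_of_windows {L H i₀ w j₀ N M a b : ℕ} {ω : Config} (hM : 0 < M)
    (ha : a ≤ i₀ * L) (hb : (i₀ + w + 1) * L ≤ b)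
    (hR : ∀ s, s * M ≤ N → ∃ r, s * M ≤ r ∧ r < (s + 1) * M ∧
      ∀ i, i₀ ≤ i → i < i₀ + w → ω ∈ site L H i (j₀ + r))
    (hS : ∀ s, s * M ≤ N → ∃ i, i₀ ≤ i ∧ i < i₀ + w ∧
      ∀ t, s * M ≤ t → t < (s + 2) * M → ω ∈ site L H i (j₀ + t)) :
    ω ∈ crossV a b (j₀ * H) ((j₀ + (N + 2)) * H) := by
  set G := openGraph a b (j₀ * H) ((j₀ + (N + 2)) * H) ω with hGdef
  have hHG : ∀ i t, i₀ ≤ i → i < i₀ + w → t ≤ N → openGraph (i * L) ((i + 2) * L)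
      ((j₀ + t) * H) ((j₀ + t + 1) * H) ω ≤ G := fun i t hi hi' ht =>
    openGraph_mono ω (ha.trans (Nat.mul_le_mul_right _ hi))
      ((Nat.mul_le_mul_right _ (by omega)).trans hb)
      (Nat.mul_le_mul_right _ (by omega)) (Nat.mul_le_mul_right _ (by omega))
  have hVG : ∀ i t, i₀ ≤ i → i < i₀ + w → t ≤ N → openGraph (i * L) ((i + 1) * L)
      ((j₀ + t) * H) ((j₀ + t + 2) * H) ω ≤ G := fun i t hi hi' ht =>
    openGraph_mono ω (ha.trans (Nat.mul_le_mul_right _ hi))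
      ((Nat.mul_le_mul_right _ (by omega)).trans hb)
      (Nat.mul_le_mul_right _ (by omega)) (Nat.mul_le_mul_right _ (by omega))
  have hab : ∀ i x, i₀ ≤ i → i < i₀ + w → x ∈ Icc (i * L) ((i + 1) * L) → x ∈ Icc a b :=
    fun i x hi hi' hx => ⟨(ha.trans (Nat.mul_le_mul_right _ hi)).trans hx.1,
      hx.2.trans ((Nat.mul_le_mul_right _ (by omega)).trans hb)⟩
  let C : ℕ → ℕ → Prop := fun i t => ∃ x ∈ Icc a b,
    ∃ y ∈ Icc ((j₀ + t) * H) ((j₀ + t + 1) * H), ∃ y',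
      (openGraph (i * L) ((i + 2) * L) ((j₀ + t) * H) ((j₀ + t + 1) * H) ω).Reachable
        (i * L, y) ((i + 2) * L, y') ∧ G.Reachable (x, j₀ * H) (i * L, y)
  -- Connection to the bottom passes between sites whose crossings meet a common vertical one.
  have move : ∀ i t i' t' k l, i₀ ≤ i → i < i₀ + w → t ≤ N → i₀ ≤ i' → i' < i₀ + w → t' ≤ N →
      i₀ ≤ k → k < i₀ + w → l ≤ N → (i ≤ k ∧ k ≤ i + 1) → (i' ≤ k ∧ k ≤ i' + 1) →
      (l ≤ t ∧ t ≤ l + 1) → (l ≤ t' ∧ t' ≤ l + 1) → ω ∈ site L H k (j₀ + l) →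
      ω ∈ site L H i' (j₀ + t') → C i t → C i' t' := by
    rintro i t i' t' k l h1 h2 h3 h4 h5 h6 h7 h8 h9 hi hi' ht ht' hk ⟨⟨z, hz, z', -, hzr⟩, -⟩
      ⟨x, hx, y, hy, y', hyr, hxy⟩
    refine ⟨x, hx, z, hz, z', hzr, hxy.trans ?_⟩
    exact reachable_left_ends hk.2 (hVG k l h7 h8 h9) hi hi' (by omega) (by omega) hy hz hyr hzr
      (hHG i t h1 h2 h3) (hHG i' t' h4 h5 h6)
  have key : ∃ i, i₀ ≤ i ∧ i < i₀ + w ∧ ω ∈ site L H i (j₀ + N) ∧ C i N := by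
    refine exists_connected_top (C := C) (O := fun i t => ω ∈ site L H i (j₀ + t)) hM ?_ ?_ ?_
      hR hS
    · intro i t hi hi' ht hO hO'
      exact ⟨move i t (i + 1) t (i + 1) t hi (by omega) ht (by omega) hi' ht (by omega) hi' ht
          (by omega) (by omega) (by omega) (by omega) hO' hO',
        move (i + 1) t i t (i + 1) t (by omega) hi' ht hi (by omega) ht (by omega) hi' ht
          (by omega) (by omega) (by omega) (by omega) hO' hO⟩
    · intro i t hi hi' ht hO hO'
      exact ⟨move i t i (t + 1) i t hi hi' (by omega) hi hi' ht hi hi' (by omega)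
          (by omega) (by omega) (by omega) (by omega) hO hO',
        move i (t + 1) i t i t hi hi' ht hi hi' (by omega) hi hi' (by omega)
          (by omega) (by omega) (by omega) (by omega) hO hO⟩
    · rintro i hi hi' ⟨⟨z, hz, z', -, hzr⟩, ⟨u, hu, u', hu', hur⟩⟩
      refine ⟨u, hab i u hi hi' hu, z, hz, z', hzr, ?_⟩
      refine (reachable_of_crossings le_rfl ?_ le_rfl ?_ hz hu hzr hur
        (hHG i 0 hi hi' (by omega)) (hVG i 0 hi hi' (by omega))).symm <;>
      exact Nat.mul_le_mul_right _ (by omega)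
  obtain ⟨i, hi, hi', ⟨-, u, hu, u', hu', hur⟩, x, hx, y, hy, y', hyr, hxy⟩ := key
  refine ⟨x, hx, u', hab i u' hi hi' hu', hxy.trans ?_⟩
  refine (reachable_of_crossings le_rfl ?_ le_rfl ?_ hy hu hyr hur
    (hHG i N hi hi' le_rfl) (hVG i N hi hi' le_rfl)).trans ?_
  · exact Nat.mul_le_mul_right _ (by omega)
  · exact Nat.mul_le_mul_right _ (by omega)
  · rw [← Nat.add_assoc]
    exact hur.mono (hVG i N hi hi' le_rfl)

/-- If `r` bounds the failure probabilities of the sites in `2 n - 1` adjacent columns, then a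
rectangle of `N + 2` rows of blocks fails to be crossed vertically with probability of order
`r ^ n`: in some window, `n` independent rows or `n` independent columns have to fail. -/
theorem law_compl_crossV_le (p : I) (Λ : Set ℕ) {L H i₀ j₀ n N a b : ℕ} {r : ℝ} (hn : 0 < n)
    (ha : a ≤ i₀ * L) (hb : (i₀ + 2 * n) * L ≤ b)
    (hr : ∀ i, i₀ ≤ i → i + 1 < i₀ + 2 * n → ∀ j, (law p Λ).real (site L H i j)ᶜ ≤ r) :
    (law p Λ).real (crossV a b (j₀ * H) ((j₀ + (N + 2)) * H))ᶜ ≤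
      2 * (N + 1) * (4 * n * r) ^ n := by
  have hr0 : 0 ≤ r := measureReal_nonneg.trans (hr i₀ le_rfl (by omega) 0)
  let row : ℕ → ℕ → Set Config := fun s t =>
    (⋂ i ∈ Finset.range (2 * n - 1), site L H (i₀ + i) (j₀ + (s * (2 * n) + 2 * t)))ᶜ
  let col : ℕ → ℕ → Set Config := fun s t =>
    (⋂ u ∈ Finset.range (4 * n), site L H (i₀ + 2 * t) (j₀ + (s * (2 * n) + u)))ᶜ
  have hrow : ∀ s, (law p Λ).real (⋂ t ∈ Finset.range n, row s t) ≤ (4 * n * r) ^ n := by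
    intro s
    refine law_iInter_le_pow p Λ (T := fun t => rectFinset (i₀ * L) ((i₀ + 2 * n) * L)
      ((j₀ + (s * (2 * n) + 2 * t)) * H) ((j₀ + (s * (2 * n) + 2 * t) + 2) * H)) ?_ ?_ n ?_
    · refine fun t => (IsLocal.iInter fun i => IsLocal.iInter fun hi => ?_).compl
      have := Finset.mem_range.1 hi
      exact (isLocal_site _ _ _ _).mono (rectFinset_mono (Nat.mul_le_mul_right _ (by omega))
        (Nat.mul_le_mul_right _ (by omega)) le_rfl le_rfl)
    · intro t t' htt'
      rcases lt_or_gt_of_ne htt' with h | h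
      · exact disjoint_rectFinset_of_le_bottom (Nat.mul_le_mul_right _ (by omega))
      · exact (disjoint_rectFinset_of_le_bottom (Nat.mul_le_mul_right _ (by omega))).symm
    · intro t _
      refine (law_compl_biInter_le p Λ fun i hi => hr _ (by omega) (by omega) _).trans ?_
      refine mul_le_mul_of_nonneg_right ?_ hr0
      exact_mod_cast (by omega : 2 * n - 1 ≤ 4 * n)
  have hcol : ∀ s, (law p Λ).real (⋂ t ∈ Finset.range n, col s t) ≤ (4 * n * r) ^ n := by
    intro s
    refine law_iInter_le_pow p Λ (T := fun t => rectFinset ((i₀ + 2 * t) * L)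
      ((i₀ + 2 * t + 2) * L) (j₀ * H) ((j₀ + (s * (2 * n) + 4 * n + 2)) * H)) ?_ ?_ n ?_
    · refine fun t => (IsLocal.iInter fun u => IsLocal.iInter fun hu => ?_).compl
      have := Finset.mem_range.1 hu
      exact (isLocal_site _ _ _ _).mono (rectFinset_mono le_rfl le_rfl
        (Nat.mul_le_mul_right _ (by omega)) (Nat.mul_le_mul_right _ (by omega)))
    · intro t t' htt'
      rcases lt_or_gt_of_ne htt' with h | h
      · exact disjoint_rectFinset_of_le_left (Nat.mul_le_mul_right _ (by omega))
      · exact (disjoint_rectFinset_of_le_left (Nat.mul_le_mul_right _ (by omega))).symm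
    · intro t ht
      refine (law_compl_biInter_le p Λ fun u hu => hr _ (by omega) (by omega) _).trans ?_
      push_cast
      rfl
  have hsub : (crossV a b (j₀ * H) ((j₀ + (N + 2)) * H))ᶜ ⊆ ⋃ s ∈ Finset.range (N + 1),
      ((⋂ t ∈ Finset.range n, row s t) ∪ ⋂ t ∈ Finset.range n, col s t) := by
    intro ω hω
    by_contra hcon
    apply hω
    have hs : ∀ s, s * (2 * n) ≤ N → (∃ t < n, ω ∉ row s t) ∧ ∃ t < n, ω ∉ col s t := by
      intro s hs
      have hsN : s < N + 1 := by nlinarith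
      simp only [mem_iUnion, mem_union, mem_iInter, Finset.mem_range, not_exists, not_or] at hcon
      obtain ⟨h1, h2⟩ := hcon s hsN
      push Not at h1 h2
      exact ⟨by simpa using h1, by simpa using h2⟩
    refine mem_crossV_of_windows (w := 2 * n - 1) (i₀ := i₀) (M := 2 * n) (by omega) ha
      ((Nat.mul_le_mul_right _ (by omega)).trans hb) ?_ ?_
    · intro s hsN
      obtain ⟨⟨t, ht, h⟩, -⟩ := hs s hsN
      have e : (s + 1) * (2 * n) = s * (2 * n) + 2 * n := by ring
      refine ⟨s * (2 * n) + 2 * t, by omega, by omega, fun i hi hi' => ?_⟩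
      simp only [row, notMem_compl_iff, mem_iInter, Finset.mem_range] at h
      have := h (i - i₀) (by omega)
      rwa [Nat.add_sub_of_le hi] at this
    · intro s hsN
      obtain ⟨-, t, ht, h⟩ := hs s hsN
      have e : (s + 2) * (2 * n) = s * (2 * n) + 4 * n := by ring
      refine ⟨i₀ + 2 * t, by omega, by omega, fun u hu hu' => ?_⟩
      simp only [col, notMem_compl_iff, mem_iInter, Finset.mem_range] at h
      have := h (u - s * (2 * n)) (by omega)
      rwa [Nat.add_sub_of_le hu] at this
  refine (measureReal_mono hsub (measure_ne_top _ _)).trans ?_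
  refine (measureReal_biUnion_finset_le _ _).trans ?_
  refine (Finset.sum_le_card_nsmul _ _ (2 * (4 * n * r) ^ n) fun s _ => ?_).trans (le_of_eq ?_)
  · linarith [measureReal_union_le (μ := law p Λ) (⋂ t ∈ Finset.range n, row s t)
      (⋂ t ∈ Finset.range n, col s t), hrow s, hcol s]
  · simp; ring

/-! ### Horizontal crossings of renormalized rectangles -/

/-- A rectangle with `w` columns of blocks is crossed horizontally if the good columns are crossed
vertically and linked by horizontal crossings, and a straight segment at the upper ends of the
vertical crossings bridges every pair of adjacent columns that are not both good. -/
theorem mem_crossH_of_bridges {L H i₀ w j c d : ℕ} {ω : Config} {good : ℕ → Prop} (hw : 2 ≤ w)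
    (hc : c ≤ j * H) (hd : (j + 2) * H < d)
    (hV : ∀ i, i₀ ≤ i → i < i₀ + w → good i → ω ∈ blockV L H i j)
    (hH : ∀ i, i₀ ≤ i → i + 1 < i₀ + w → good i → good (i + 1) → ω ∈ blockH L H i j)
    (hB : ∀ i, i₀ ≤ i → i + 1 < i₀ + w → ¬ (good i ∧ good (i + 1)) →
      ∀ t ∈ Ico (i * L) ((i + 2) * L), ω ((t, (j + 2) * H), true) = true) :
    ω ∈ crossH (i₀ * L) ((i₀ + w) * L) c d := by
  set G := openGraph (i₀ * L) ((i₀ + w) * L) c d ω with hG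
  set h := (j + 2) * H with hh
  have hjh : (j + 1) * H ≤ h := Nat.mul_le_mul_right _ (by omega)
  have hjj : j * H ≤ (j + 1) * H := Nat.mul_le_mul_right _ (by omega)
  -- An anchor of a column is a point at height `h`, the end of a vertical crossing if possible.
  let anchor : ℕ → ℕ → Prop := fun i x => x ∈ Icc (i * L) ((i + 1) * L) ∧ (good i →
    ∃ x₀ ∈ Icc (i * L) ((i + 1) * L),
      (openGraph (i * L) ((i + 1) * L) (j * H) h ω).Reachable (x₀, j * H) (x, h))
  have hex : ∀ i, i₀ ≤ i → i < i₀ + w → ∃ x, anchor i x := by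
    intro i hi hi'
    by_cases hg : good i
    · obtain ⟨x₀, hx₀, x, hx, hr⟩ := hV i hi hi' hg
      exact ⟨x, hx, fun _ => ⟨x₀, hx₀, hr⟩⟩
    · exact ⟨i * L, ⟨le_rfl, Nat.mul_le_mul_right _ (by omega)⟩, fun h => absurd h hg⟩
  have hVG : ∀ i, i₀ ≤ i → i < i₀ + w → openGraph (i * L) ((i + 1) * L) (j * H) h ω ≤ G :=
    fun i hi hi' => openGraph_mono ω (Nat.mul_le_mul_right _ hi)
      (Nat.mul_le_mul_right _ (by omega)) hc hd.le
  have pair : ∀ i, i₀ ≤ i → i + 1 < i₀ + w → ∃ z ∈ Icc c d, ∃ z' ∈ Icc c d, ∀ x x',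
      anchor i x → anchor (i + 1) x' → G.Reachable (i * L, z) (x, h) ∧
        G.Reachable (x, h) (x', h) ∧ G.Reachable (x', h) ((i + 2) * L, z') := by
    intro i hi hi'
    by_cases hg : good i ∧ good (i + 1)
    · obtain ⟨z, hz, z', hz', hr⟩ := hH i hi hi' hg.1 hg.2
      refine ⟨z, ⟨hc.trans hz.1, by have := hz.2; omega⟩, z',
        ⟨hc.trans hz'.1, by have := hz'.2; omega⟩, ?_⟩
      rintro x x' ⟨hx, hax⟩ ⟨hx', hax'⟩
      obtain ⟨u, hu, hur⟩ := hax hg.1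
      obtain ⟨v, hv, hvr⟩ := hax' hg.2
      have hHG : openGraph (i * L) ((i + 2) * L) (j * H) ((j + 1) * H) ω ≤ G :=
        openGraph_mono ω (Nat.mul_le_mul_right _ hi) (Nat.mul_le_mul_right _ (by omega)) hc
          (by omega)
      have h1 : G.Reachable (i * L, z) (x, h) :=
        (reachable_of_crossings le_rfl (Nat.mul_le_mul_right _ (by omega)) le_rfl hjh hz hu hr hur
          hHG (hVG i hi (by omega))).trans (hur.mono (hVG i hi (by omega)))
      have h2 : G.Reachable (i * L, z) (x', h) :=
        (reachable_of_crossings (Nat.mul_le_mul_right _ (by omega)) le_rfl le_rfl hjh hz hv hr hvr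
          hHG (hVG (i + 1) (by omega) hi')).trans (hvr.mono (hVG (i + 1) (by omega) hi'))
      exact ⟨h1, h1.symm.trans h2, h2.symm.trans (hr.mono hHG)⟩
    · have hb := hB i hi hi' hg
      have hhm : h ∈ Icc c d := ⟨by omega, by omega⟩
      refine ⟨h, hhm, h, hhm, ?_⟩
      rintro x x' ⟨hx, -⟩ ⟨hx', -⟩
      have e1 : i₀ * L ≤ i * L := Nat.mul_le_mul_right _ hi
      have e2 : (i + 2) * L ≤ (i₀ + w) * L := Nat.mul_le_mul_right _ (by omega)
      have e3 : (i + 1) * L ≤ (i + 2) * L := Nat.mul_le_mul_right _ (by omega)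
      have e4 : (i + 1 + 1) * L = (i + 2) * L := rfl
      simp only [mem_Icc] at hx hx'
      have seg : ∀ s s', i * L ≤ s → s ≤ s' → s' ≤ (i + 2) * L → G.Reachable (s, h) (s', h) :=
        fun s s' h1 h2 h3 => reachable_of_row_open (by omega) h2 (by omega)
          ⟨by omega, hd⟩ fun t ht => hb t ⟨by have := ht.1; omega, by have := ht.2; omega⟩
      exact ⟨seg _ _ le_rfl (by omega) (by omega), seg _ _ (by omega) (by omega) (by omega),
        seg _ _ (by omega) (by omega) le_rfl⟩
  obtain ⟨z, hz, _, _, h0⟩ := pair i₀ le_rfl (by omega)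
  have chain : ∀ u, u + 1 < w → ∀ x', anchor (i₀ + u + 1) x' →
      G.Reachable (i₀ * L, z) (x', h) := by
    intro u
    induction u with
    | zero =>
      intro _ x' hx'
      obtain ⟨x, hx⟩ := hex i₀ le_rfl (by omega)
      exact (h0 x x' hx hx').1.trans (h0 x x' hx hx').2.1
    | succ u ih =>
      intro hu x' hx'
      obtain ⟨x, hx⟩ := hex (i₀ + u + 1) (by omega) (by omega)
      obtain ⟨_, _, _, _, h1⟩ := pair (i₀ + u + 1) (by omega) (by omega)
      exact (ih (by omega) x hx).trans (h1 x x' hx hx').2.1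
  obtain ⟨v, rfl⟩ := Nat.exists_eq_add_of_le' hw
  obtain ⟨x, hx⟩ := hex (i₀ + v) (by omega) (by omega)
  obtain ⟨x', hx'⟩ := hex (i₀ + v + 1) (by omega) (by omega)
  obtain ⟨_, _, z', hz', h1⟩ := pair (i₀ + v) (by omega) (by omega)
  exact ⟨z, hz, z', hz', (chain v (by omega) x' hx').trans (h1 x x' hx hx').2.2⟩

open scoped Classical in
/-- If at most four columns are bad, each of `m` independent strips of four rows of blocks
contains a horizontal crossing with probability at least `p ^ (12 L) / 2`: the good columns are
linked with probability at least `1 / 2`, and the bridges consist of at most `12 L` further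
edges. -/
theorem law_compl_crossH_le (p : I) (Λ : Set ℕ) {L H i₀ w j₀ m N : ℕ} {q : ℝ} {good : ℕ → Prop}
    (hH0 : 0 < H) (hw : 2 ≤ w) (hmN : 4 * m ≤ N)
    (hbad : ((Finset.Ico i₀ (i₀ + w)).filter fun i => ¬ good i).card ≤ 4) (hq0 : 0 ≤ q)
    (hq : w * (2 * q) ≤ 1 / 2)
    (hV : ∀ i j, good i → (law p Λ).real (blockV L H i j)ᶜ ≤ q)
    (hH : ∀ i j, good i → good (i + 1) → (law p Λ).real (blockH L H i j)ᶜ ≤ q) :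
    (law p Λ).real (crossH (i₀ * L) ((i₀ + w) * L) (j₀ * H) ((j₀ + N) * H))ᶜ ≤
      (1 - (p : ℝ) ^ (12 * L) / 2) ^ m := by
  set bad := (Finset.Ico i₀ (i₀ + w)).filter fun i => ¬ good i with hbaddef
  let X : Finset ℕ := bad.biUnion fun b => Finset.Ico ((b - 1) * L) ((b + 2) * L)
  have hX : X.card ≤ 12 * L := by
    refine (Finset.card_biUnion_le_card_mul _ _ (3 * L) fun b _ => ?_).trans ?_
    · rw [Nat.card_Ico, ← Nat.sub_mul]
      exact Nat.mul_le_mul_right _ (by omega)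
    · nlinarith
  let S : ℕ → Finset Edge := fun j => X.image fun t => ((t, (j + 2) * H), true)
  have hScard : ∀ j, (S j).card ≤ 12 * L := fun j => Finset.card_image_le.trans hX
  let F : ℕ → ℕ → Set Config := fun j u =>
    {ω | good (i₀ + u) → ω ∈ blockV L H (i₀ + u) j} ∩
      {ω | good (i₀ + u) ∧ good (i₀ + u + 1) → ω ∈ blockH L H (i₀ + u) j}
  let D : ℕ → Set Config := fun s =>
    (⋂ u ∈ Finset.range w, F (j₀ + 4 * s) u) ∩ {ω | ∀ e ∈ S (j₀ + 4 * s), ω e = true}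
  have hFloc : ∀ j, IsLocal (⋂ u ∈ Finset.range w, F j u)
      (rectFinset 0 ((i₀ + w + 1) * L) (j * H) ((j + 2) * H)) := by
    refine fun j => IsLocal.iInter fun u => IsLocal.iInter fun hu => ?_
    have := Finset.mem_range.1 hu
    have hsub : rectFinset ((i₀ + u) * L) ((i₀ + u + 2) * L) (j * H) ((j + 2) * H) ⊆
        rectFinset 0 ((i₀ + w + 1) * L) (j * H) ((j + 2) * H) :=
      rectFinset_mono (Nat.zero_le _) (Nat.mul_le_mul_right _ (by omega)) le_rfl le_rfl
    refine (IsLocal.inter ?_ ?_)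
    · exact fun ω ω' h hω hg => (isLocal_blockV L H _ j).mono hsub ω ω' h (hω hg)
    · exact fun ω ω' h hω hg => (isLocal_blockH L H _ j).mono hsub ω ω' h (hω hg)
  have hSsub : ∀ j, S j ⊆ rectFinset 0 ((i₀ + w + 1) * L) ((j + 2) * H) ((j + 3) * H) := by
    intro j e he
    simp only [S, X, Finset.mem_image, Finset.mem_biUnion, Finset.mem_Ico] at he
    obtain ⟨t, ⟨b, hb, -, htb⟩, rfl⟩ := he
    have hb' := Finset.mem_Ico.1 (Finset.mem_filter.1 hb).1
    rw [mem_rectFinset]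
    refine ⟨⟨Nat.zero_le _, htb.trans_le (Nat.mul_le_mul_right _ (by omega))⟩, le_rfl, ?_⟩
    exact Nat.mul_lt_mul_of_pos_right (by omega) hH0
  have hFprob : ∀ j, 1 / 2 ≤ (law p Λ).real (⋂ u ∈ Finset.range w, F j u) := by
    intro j
    have h1 : (law p Λ).real (⋂ u ∈ Finset.range w, F j u)ᶜ ≤ w * (2 * q) := by
      refine law_compl_biInter_le p Λ fun u _ => law_compl_inter_le p Λ ?_ ?_
      · by_cases hg : good (i₀ + u)
        · simpa [hg] using hV (i₀ + u) j hg
        · simpa [hg] using hq0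
      · by_cases hg : good (i₀ + u) ∧ good (i₀ + u + 1)
        · simpa [hg] using hH (i₀ + u) j hg.1 hg.2
        · simpa [hg] using hq0
    rw [measureReal_compl (hFloc j).measurableSet, probReal_univ] at h1
    linarith
  have hDloc : ∀ s, IsLocal (D s) (rectFinset 0 ((i₀ + w + 1) * L) ((j₀ + 4 * s) * H)
      ((j₀ + 4 * s + 3) * H)) := fun s =>
    ((hFloc _).mono (rectFinset_mono le_rfl le_rfl le_rfl
      (Nat.mul_le_mul_right _ (by omega)))).inter
      ((isLocal_all_open _).mono ((hSsub _).trans (rectFinset_mono le_rfl le_rfl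
        (Nat.mul_le_mul_right _ (by omega)) le_rfl)))
  have hDprob : ∀ s, (law p Λ).real (D s)ᶜ ≤ 1 - (p : ℝ) ^ (12 * L) / 2 := by
    intro s
    rw [measureReal_compl (hDloc s).measurableSet, probReal_univ,
      law_inter_of_isLocal p Λ (hFloc _) (isLocal_all_open _)
        ((disjoint_rectFinset_of_le_bottom le_rfl).mono_right (hSsub _)),
      law_all_open p Λ]
    · have h1 : (p : ℝ) ^ (12 * L) ≤ (p : ℝ) ^ (S (j₀ + 4 * s)).card :=
        pow_le_pow_of_le_one p.2.1 p.2.2 (hScard _)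
      have h2 : (0 : ℝ) ≤ (p : ℝ) ^ (12 * L) := pow_nonneg p.2.1 _
      have := mul_le_mul (hFprob (j₀ + 4 * s)) h1 h2 measureReal_nonneg
      linarith
    · intro e he
      obtain ⟨t, -, rfl⟩ := Finset.mem_image.1 he
      simp [edgeProb]
  have hsub : (crossH (i₀ * L) ((i₀ + w) * L) (j₀ * H) ((j₀ + N) * H))ᶜ ⊆
      ⋂ s ∈ Finset.range m, (D s)ᶜ := by
    intro ω hω
    simp only [mem_iInter, Finset.mem_range]
    rintro s hs ⟨hF, hS⟩
    apply hω
    simp only [mem_iInter, Finset.mem_range] at hF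
    refine mem_crossH_of_bridges (good := good) (j := j₀ + 4 * s) hw
      (Nat.mul_le_mul_right _ (by omega)) (Nat.mul_lt_mul_of_pos_right (by omega) hH0) ?_ ?_ ?_
    · intro i hi hi' hg
      obtain ⟨u, rfl⟩ := Nat.exists_eq_add_of_le hi
      exact (hF u (by omega)).1 hg
    · intro i hi hi' hg hg'
      obtain ⟨u, rfl⟩ := Nat.exists_eq_add_of_le hi
      exact (hF u (by omega)).2 ⟨hg, hg'⟩
    · intro i hi hi' hg t ht
      refine hS _ (Finset.mem_image.2 ⟨t, Finset.mem_biUnion.2 ?_, rfl⟩)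
      simp only [Finset.mem_Ico]
      by_cases hgi : good i
      · refine ⟨i + 1, Finset.mem_filter.2 ⟨Finset.mem_Ico.2 ⟨by omega, hi'⟩,
          fun h => hg ⟨hgi, h⟩⟩, ?_, ht.2.trans_le (Nat.mul_le_mul_right _ (by omega))⟩
        exact (Nat.mul_le_mul_right _ (by omega)).trans ht.1
      · refine ⟨i, Finset.mem_filter.2 ⟨Finset.mem_Ico.2 ⟨hi, by omega⟩, hgi⟩, ?_, ht.2⟩
        exact (Nat.mul_le_mul_right _ (by omega)).trans ht.1
  refine (measureReal_mono hsub (measure_ne_top _ _)).trans ?_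
  refine law_iInter_le_pow p Λ (fun s => (hDloc s).compl) ?_ m fun s _ => hDprob s
  intro s s' hss'
  rcases lt_or_gt_of_ne hss' with h | h
  · exact disjoint_rectFinset_of_le_bottom (Nat.mul_le_mul_right _ (by omega))
  · exact (disjoint_rectFinset_of_le_bottom (Nat.mul_le_mul_right _ (by omega))).symm

/-! ### Good intervals -/

open scoped Classical in
/-- If no two failures of `P` in `[u, v)` are more than one apart, there are at most two. -/
lemma card_filter_not_le_two {P : ℕ → Prop} {u v : ℕ}
    (h : ¬ ∃ a ∈ Ico u v, ∃ b ∈ Ico u v, a + 1 < b ∧ ¬ P a ∧ ¬ P b) :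
    ((Finset.Ico u v).filter fun i => ¬ P i).card ≤ 2 := by
  rcases ((Finset.Ico u v).filter fun i => ¬ P i).eq_empty_or_nonempty with h0 | h0
  · simp [h0]
  · refine (Finset.card_le_card (t := {Finset.min' _ h0, Finset.min' _ h0 + 1}) ?_).trans
      Finset.card_le_two
    intro b hb
    have hm := Finset.mem_filter.1 (Finset.min'_mem _ h0)
    have hle := Finset.min'_le _ b hb
    have hb' := Finset.mem_filter.1 hb
    by_contra hcon
    simp only [Finset.mem_insert, Finset.mem_singleton, not_or] at hcon
    exact h ⟨_, Finset.mem_Ico.1 hm.1, b, Finset.mem_Ico.1 hb'.1, by omega, hm.2, hb'.2⟩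

/-- If no two failures of `P` in `[u, v)` are more than one apart, then the first or the last `m`
points of `[u, v)` satisfy `P`, for every `m < (v - u) / 2`. -/
lemma exists_run_of_not_separated {P : ℕ → Prop} {u v m : ℕ} (hm : u + 2 * m < v)
    (h : ¬ ∃ a ∈ Ico u v, ∃ b ∈ Ico u v, a + 1 < b ∧ ¬ P a ∧ ¬ P b) :
    ∃ s, u ≤ s ∧ s + m ≤ v ∧ ∀ t, s ≤ t → t < s + m → P t := by
  by_cases h1 : ∀ t, u ≤ t → t < u + m → P t
  · exact ⟨u, le_rfl, by omega, h1⟩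
  · push Not at h1
    obtain ⟨a, ha, ha', hPa⟩ := h1
    refine ⟨v - m, by omega, by omega, fun t ht ht' => ?_⟩
    by_contra hPt
    exact h ⟨a, ⟨ha, by omega⟩, t, ⟨by omega, by omega⟩, by omega, hPa, hPt⟩

lemma isGood_succ_iff {A : ℝ} {k₀ k i : ℕ} {Λ : Set ℕ} (hk : k₀ ≤ k) :
    IsGood A k₀ Λ (k + 1) i ↔ ¬ ∃ a ∈ children A k i, ∃ b ∈ children A k i,
        a + 1 < b ∧ ¬ IsGood A k₀ Λ k a ∧ ¬ IsGood A k₀ Λ k b := by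
  rw [IsGood, if_neg (by omega)]

lemma IsGood.nonempty {A : ℝ} (hA : 3 ≤ A) {k₀ : ℕ} {Λ : Set ℕ} {k i : ℕ}
    (h : IsGood A k₀ Λ k i) : (Λ ∩ block A k i).Nonempty := by
  induction k generalizing i with
  | zero => exact h
  | succ k ih =>
    by_cases hk : k + 1 ≤ k₀
    · rwa [IsGood, if_pos hk] at h
    · rw [isGood_succ_iff (by omega)] at h
      have hW3 : 3 ≤ ⌊A ^ (k + 2)⌋₊ := Nat.le_floor (by
        push_cast
        exact hA.trans (le_self_pow₀ (by linarith) (by omega)))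
      obtain ⟨s, hs, hs', hP⟩ := exists_run_of_not_separated (m := 1)
        (by have : (i + 1) * ⌊A ^ (k + 2)⌋₊ = i * ⌊A ^ (k + 2)⌋₊ + ⌊A ^ (k + 2)⌋₊ := by ring
            omega) h
      obtain ⟨x, hx, hx', hx''⟩ := ih (hP s le_rfl (by omega))
      refine ⟨x, hx, ?_, ?_⟩
      · rw [scale, ← mul_assoc]
        exact (Nat.mul_le_mul_right _ hs).trans hx'
      · rw [scale, ← mul_assoc]
        exact hx''.trans_le (Nat.mul_le_mul_right _ hs')

/-! ### Growth of the scales -/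

lemma log_floor_pow_le {A : ℝ} (hA : 2 ≤ A) (m : ℕ) :
    Real.log (⌊A ^ (m + 1)⌋₊ : ℝ) ≤ (m + 1) * Real.log A := by
  have h1 : (1 : ℝ) ≤ A ^ (m + 1) := one_le_pow₀ (by linarith)
  have h2 : (0 : ℝ) < ⌊A ^ (m + 1)⌋₊ := by exact_mod_cast Nat.floor_pos.2 h1
  calc Real.log (⌊A ^ (m + 1)⌋₊ : ℝ) ≤ Real.log (A ^ (m + 1)) :=
        Real.log_le_log h2 (Nat.floor_le (by linarith))
    _ = _ := by rw [Real.log_pow]; push_cast; ring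

lemma half_pow_le_floor {A : ℝ} (hA : 2 ≤ A) (m : ℕ) :
    A ^ (m + 1) / 2 ≤ (⌊A ^ (m + 1)⌋₊ : ℝ) := by
  have h1 : A ≤ A ^ (m + 1) := le_self_pow₀ (by linarith) (by omega)
  have := Nat.lt_floor_add_one (A ^ (m + 1))
  linarith

lemma le_log_floor_pow {A : ℝ} (hA : 2 ≤ A) (m : ℕ) :
    (m + 1) * Real.log A - Real.log 2 ≤ Real.log (⌊A ^ (m + 1)⌋₊ : ℝ) := by
  have h1 : (0 : ℝ) < A ^ (m + 1) := pow_pos (by linarith) _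
  calc (m + 1) * Real.log A - Real.log 2 = Real.log (A ^ (m + 1) / 2) := by
        rw [Real.log_div h1.ne' two_ne_zero, Real.log_pow]; push_cast; ring
    _ ≤ _ := Real.log_le_log (by positivity) (half_pow_le_floor hA m)

lemma two_le_scale {A : ℝ} (hA : 2 ≤ A) (k : ℕ) : 2 ≤ scale A k := by
  induction k with
  | zero => exact Nat.le_floor (by exact_mod_cast hA)
  | succ k ih =>
    have : 0 < ⌊A ^ (k + 2)⌋₊ := Nat.floor_pos.2 (one_le_pow₀ (by linarith))
    rw [scale]
    nlinarith

lemma log_scale_succ {A : ℝ} (hA : 2 ≤ A) (k : ℕ) : Real.log (scale A (k + 1)) =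
    Real.log (⌊A ^ (k + 2)⌋₊ : ℝ) + Real.log (scale A k) := by
  have h1 : 0 < ⌊A ^ (k + 2)⌋₊ := Nat.floor_pos.2 (one_le_pow₀ (by linarith))
  have h2 := two_le_scale hA k
  rw [scale, Nat.cast_mul, Real.log_mul (by positivity) (by positivity)]

lemma log_scale_le {A : ℝ} (hA : 2 ≤ A) (k : ℕ) :
    Real.log (scale A k) ≤ (k + 1) * (k + 2) / 2 * Real.log A := by
  induction k with
  | zero =>
    have := log_floor_pow_le hA 0
    simpa [scale] using this
  | succ k ih =>
    have := log_floor_pow_le hA (k + 1)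
    rw [log_scale_succ hA]
    push_cast at this ⊢
    linarith

lemma pow_le_scale {A : ℝ} (hA : 2 ≤ A) (k : ℕ) : A ^ (k + 2) ≤ scale A (k + 1) := by
  have h1 := half_pow_le_floor hA (k + 1)
  have h2 : (2 : ℝ) ≤ scale A k := by exact_mod_cast two_le_scale hA k
  have h3 : (0 : ℝ) < A ^ (k + 2) := pow_pos (by linarith) _
  rw [scale, Nat.cast_mul]
  nlinarith

lemma height_pos (A β : ℝ) (k : ℕ) : 0 < height A β k := by
  induction k with
  | zero => simp [height]
  | succ k ih =>
    rw [height]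
    have := Nat.ceil_pos.2 (Real.exp_pos ((scale A (k + 1) : ℝ) ^ (1 - β / ((k : ℝ) + 2))))
    positivity

/-- The gain of one renormalization step: passing from scale `k` to scale `k + 1` costs the
exponent a factor that is smaller than the number of blocks by `A ^ (μ / 2) / 2 > 48`. -/
lemma rpow_scale_succ_le {A μ : ℝ} (hA : 2 ≤ A) (hμ0 : 0 < μ) (hμ1 : μ < 1)
    (hAμ : Real.log 96 ≤ μ / 2 * Real.log A) (k : ℕ) :
    48 * (scale A (k + 1) : ℝ) ^ (1 - μ / ((k : ℝ) + 2)) ≤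
      ⌊A ^ (k + 2)⌋₊ * (scale A k : ℝ) ^ (1 - μ / ((k : ℝ) + 1)) := by
  have hW : (0 : ℝ) < ⌊A ^ (k + 2)⌋₊ := by
    exact_mod_cast Nat.floor_pos.2 (one_le_pow₀ (by linarith : (1 : ℝ) ≤ A))
  have hL : (0 : ℝ) < scale A k := by
    have := two_le_scale hA k
    positivity
  have hL' : (0 : ℝ) < scale A (k + 1) := by
    have := two_le_scale hA (k + 1)
    positivity
  rw [← Real.log_le_log_iff (by positivity) (by positivity), Real.log_mul (by norm_num)
    (by positivity), Real.log_mul (by positivity) (by positivity), Real.log_rpow hL',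
    Real.log_rpow hL, log_scale_succ hA]
  have hw := le_log_floor_pow hA (k + 1)
  have hl := log_scale_le hA k
  have h96 : Real.log 96 = Real.log 48 + Real.log 2 := by
    rw [← Real.log_mul (by norm_num) (by norm_num)]; norm_num
  have hlog2 : 0 < Real.log 2 := Real.log_pos (by norm_num)
  push_cast at hw
  set w := Real.log (⌊A ^ (k + 2)⌋₊ : ℝ)
  set l := Real.log (scale A k)
  set a := Real.log A
  have hk : (0 : ℝ) ≤ k := Nat.cast_nonneg k
  have h1 : a / 2 - Real.log 2 ≤ (w + l) / (k + 2) - l / (k + 1) := by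
    have e : (w + l) / ((k : ℝ) + 2) - l / (k + 1) =
        ((k + 1) * w - l) / ((k + 1) * (k + 2)) := by field_simp; ring
    rw [e, le_div_iff₀ (by positivity)]
    have h3 : ((k : ℝ) + 1) * ((k + 2) * a - Real.log 2) ≤ (k + 1) * w :=
      mul_le_mul_of_nonneg_left (by linarith) (by positivity)
    nlinarith [mul_nonneg (mul_nonneg hk hk) hlog2.le, mul_nonneg hk hlog2.le]
  have h2 := mul_le_mul_of_nonneg_left h1 hμ0.le
  have e1 : μ * ((w + l) / ((k : ℝ) + 2) - l / (k + 1)) =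
      μ / (k + 2) * (w + l) - μ / (k + 1) * l := by ring
  rw [e1] at h2
  nlinarith

/-- For `x ≥ 1`, a power of `x` with exponent `1 - θ / m` is at least `√x` if `θ ≤ 1`, `m ≥ 2`. -/
lemma sqrt_le_rpow {x θ m : ℝ} (hx : 1 ≤ x) (hθ : θ ≤ 1) (hm : 2 ≤ m) :
    Real.sqrt x ≤ x ^ (1 - θ / m) := by
  rw [Real.sqrt_eq_rpow]
  refine Real.rpow_le_rpow_of_exponent_le hx ?_
  have : θ / m ≤ 1 / 2 := by
    rw [div_le_div_iff₀ (by linarith) (by norm_num)]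
    linarith
  linarith

lemma log_le_rpow_scale {A μ : ℝ} (hA : 9216 < A) (hμ1 : μ < 1) (k : ℕ) :
    6 * Real.log (8 * ⌊A ^ (k + 3)⌋₊) ≤ (scale A (k + 1) : ℝ) ^ (1 - μ / ((k : ℝ) + 2)) := by
  have hA2 : 2 ≤ A := by linarith
  have hpow : A ^ 2 ≤ A ^ (k + 2) := pow_le_pow_right₀ (by linarith) (by omega)
  have hW : (0 : ℝ) < ⌊A ^ (k + 3)⌋₊ := by
    exact_mod_cast Nat.floor_pos.2 (one_le_pow₀ (by linarith : (1 : ℝ) ≤ A))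
  have hsc := pow_le_scale hA2 k
  have hk : (0 : ℝ) ≤ k := Nat.cast_nonneg k
  refine le_trans ?_ ((Real.sqrt_le_sqrt hsc).trans (sqrt_le_rpow (by nlinarith) hμ1.le
    (by linarith)))
  set z := Real.sqrt (A ^ (k + 2)) with hz
  have hz2 : z ^ 2 = A ^ (k + 2) := Real.sq_sqrt (by positivity)
  have hzA : A ≤ z := Real.le_sqrt_of_sq_le hpow
  have hlogz : 2 * Real.log z = (k + 2) * Real.log A := by
    have := congrArg Real.log hz2
    rw [Real.log_pow, Real.log_pow] at this
    push_cast at this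
    exact this
  have hW' := log_floor_pow_le hA2 (k + 2)
  push_cast at hW'
  have hlogA : 0 < Real.log A := Real.log_pos (by linarith)
  have hlog8 : Real.log 8 ≤ 7 := by
    have := Real.log_le_sub_one_of_pos (by norm_num : (0 : ℝ) < 8)
    linarith
  rw [Real.log_mul (by norm_num) hW.ne']
  have h1 : (k + 2 + 1) * Real.log A ≤ 3 * Real.log z := by nlinarith
  -- `log z = 2 log √z ≤ 2 √z`, and `√z ≥ 96`
  set s := Real.sqrt z with hs
  have hs2 : s ^ 2 = z := Real.sq_sqrt (by linarith)
  have hs96 : 96 ≤ s := Real.le_sqrt_of_sq_le (by linarith)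
  have h2 : Real.log z ≤ 2 * s := by
    have h3 := Real.log_le_sub_one_of_pos (by linarith : 0 < s)
    rw [← hs2, Real.log_pow]
    push_cast
    linarith
  nlinarith

lemma two_mul_scale_le {A β : ℝ} (hA : 9216 < A) (hβ0 : 0 < β) (hβ1 : β < 1) (k : ℕ) :
    2 * (scale A (k + 1) : ℝ) ≤ (scale A (k + 2) : ℝ) ^ (1 - β / ((k : ℝ) + 3)) := by
  have hA2 : 2 ≤ A := by linarith
  have hL : (0 : ℝ) < scale A (k + 1) := by
    have := two_le_scale hA2 (k + 1)
    positivity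
  have hL' : (0 : ℝ) < scale A (k + 2) := by
    have := two_le_scale hA2 (k + 2)
    positivity
  rw [← Real.log_le_log_iff (by positivity) (by positivity), Real.log_mul (by norm_num)
    (by positivity), Real.log_rpow hL']
  have h1 := log_scale_succ hA2 (k + 1)
  have h2 := le_log_floor_pow hA2 (k + 2)
  have h3 := log_scale_le hA2 (k + 2)
  have hk : (0 : ℝ) ≤ k := Nat.cast_nonneg k
  have hlog2 : Real.log 4 ≤ Real.log A := Real.log_le_log (by norm_num) (by linarith)
  have h4 : Real.log 4 = 2 * Real.log 2 := by
    rw [show (4 : ℝ) = 2 ^ 2 by norm_num, Real.log_pow]; norm_num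
  have hlog20 : 0 < Real.log 2 := Real.log_pos (by norm_num)
  push_cast at h1 h2 h3
  set l' := Real.log (scale A (k + 2))
  set a := Real.log A
  have h5 : β / (k + 3) * l' ≤ (k + 4) / 2 * a := by
    have h6 : l' ≤ (k + 3) * ((k + 4) / 2 * a) := by nlinarith
    have h7 : β / ((k : ℝ) + 3) * l' ≤ β / (k + 3) * ((k + 3) * ((k + 4) / 2 * a)) :=
      mul_le_mul_of_nonneg_left h6 (by positivity)
    have h8 : β / ((k : ℝ) + 3) * ((k + 3) * ((k + 4) / 2 * a)) = β * ((k + 4) / 2 * a) := by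
      field_simp
    have h9 : 0 ≤ (k + 4) / 2 * a := mul_nonneg (by positivity) (by linarith)
    nlinarith
  nlinarith [mul_nonneg hk (by linarith : 0 ≤ a)]

lemma eight_mul_rpow_scale_le_exp {A β μ : ℝ} (hA : 9216 < A) (hμ0 : 0 < μ) (hβ1 : β < 1)
    (k : ℕ) : 8 * (scale A (k + 1) : ℝ) ^ (1 - μ / ((k : ℝ) + 2)) ≤
      Real.exp ((scale A (k + 1) : ℝ) ^ (1 - β / ((k : ℝ) + 2)) / 2) := by
  have hA2 : 2 ≤ A := by linarith
  have hk : (0 : ℝ) ≤ k := Nat.cast_nonneg k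
  have hpow : A ^ 2 ≤ A ^ (k + 2) := pow_le_pow_right₀ (by linarith) (by omega)
  have hsc := hpow.trans (pow_le_scale hA2 k)
  set x := (scale A (k + 1) : ℝ)
  have hx1 : 1 ≤ x := by nlinarith
  have hX := sqrt_le_rpow hx1 hβ1.le (by linarith : (2 : ℝ) ≤ k + 2)
  have hT : x ^ (1 - μ / ((k : ℝ) + 2)) ≤ x := by
    refine (Real.rpow_le_rpow_of_exponent_le hx1 ?_).trans_eq (Real.rpow_one x)
    have : 0 ≤ μ / ((k : ℝ) + 2) := by positivity
    linarith
  set y := Real.sqrt x with hy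
  have hy2 : y ^ 2 = x := Real.sq_sqrt (by linarith)
  have hyA : A ≤ y := Real.le_sqrt_of_sq_le hsc
  have h1 := Real.pow_div_factorial_le_exp (y / 2) (by linarith) 3
  have h2 : Real.exp (y / 2) ≤ Real.exp (x ^ (1 - β / ((k : ℝ) + 2)) / 2) :=
    Real.exp_le_exp.2 (by linarith)
  have h3 : (y / 2) ^ 3 / (Nat.factorial 3 : ℝ) = y ^ 2 * (y / 48) := by
    norm_num [Nat.factorial]; ring
  nlinarith [sq_nonneg y]

/-! ### The renormalization step -/

/-- The bound `exp (- L_k ^ (1 - μ / (k + 1)))` on the failure probabilities at scale `k`. -/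
def failBound (A μ : ℝ) (k : ℕ) : ℝ :=
  Real.exp (-((scale A k : ℝ) ^ (1 - μ / ((k : ℝ) + 1))))

/-- At scale `k`, the crossings of good intervals fail with probability at most `failBound`. -/
def CrossingBound (A β μ : ℝ) (k₀ k : ℕ) (p : I) : Prop :=
  ∀ (Λ : Set ℕ) (i j : ℕ), IsGood A k₀ Λ k i →
    (IsGood A k₀ Λ k (i + 1) → (law p Λ).real (eventH A β k i j)ᶜ ≤ failBound A μ k) ∧
      (law p Λ).real (eventV A β k i j)ᶜ ≤ failBound A μ k

/-- The estimate behind the vertical crossings, with `T` the target exponent, `Q` the exponent at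
the lower scale, `E` the number of rows of blocks up to a constant, and `n` the number of
independent columns. -/
lemma vertical_estimate {n E W : ℕ} {T Q X : ℝ} (hn0 : 0 < n) (hnW : n ≤ W) (hWn : W ≤ 8 * n)
    (hT5 : 5 ≤ T) (hXT : X ≤ T) (hE : (E : ℝ) ≤ 2 * Real.exp X)
    (hgain : 48 * T ≤ W * Q) (hlog : 6 * Real.log (8 * W) ≤ Q) :
    8 * (E : ℝ) * (4 * n * (2 * Real.exp (-Q))) ^ n ≤ Real.exp (-T) := by
  have hn : (0 : ℝ) < n := by exact_mod_cast hn0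
  have hnW' : (n : ℝ) ≤ W := by exact_mod_cast hnW
  have hWn' : (W : ℝ) ≤ 8 * n := by exact_mod_cast hWn
  have hlogn : Real.log (8 * n) ≤ Q / 6 := by
    have := Real.log_le_log (by positivity : (0 : ℝ) < 8 * n) (by linarith : 8 * (n : ℝ) ≤ 8 * W)
    linarith
  have hQ : 0 ≤ Q := by
    have : 0 ≤ Real.log (8 * (W : ℝ)) := Real.log_nonneg (by
      have : (1 : ℝ) ≤ n := by exact_mod_cast hn0
      linarith)
    linarith
  have h1 : (4 * n * (2 * Real.exp (-Q))) ^ n ≤ Real.exp (-(5 * T)) := by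
    have e : 4 * (n : ℝ) * (2 * Real.exp (-Q)) = Real.exp (Real.log (8 * n) - Q) := by
      rw [Real.exp_sub, Real.exp_log (by positivity), Real.exp_neg]
      ring
    rw [e, ← Real.exp_nat_mul]
    refine Real.exp_le_exp.2 ?_
    have h2 : (W : ℝ) * Q ≤ 8 * n * Q := mul_le_mul_of_nonneg_right hWn' hQ
    have h3 : (n : ℝ) * (Real.log (8 * n) - Q) ≤ n * (-(5 / 6 * Q)) :=
      mul_le_mul_of_nonneg_left (by linarith) hn.le
    nlinarith
  have h2 : (E : ℝ) ≤ 2 * Real.exp T := hE.trans (by linarith [Real.exp_le_exp.2 hXT])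
  have h3 : (16 : ℝ) ≤ Real.exp (3 * T) := by linarith [Real.add_one_le_exp (3 * T)]
  calc 8 * (E : ℝ) * (4 * n * (2 * Real.exp (-Q))) ^ n
      ≤ 8 * (2 * Real.exp T) * Real.exp (-(5 * T)) := by gcongr
    _ = 16 * Real.exp (-(4 * T)) := by
        rw [show -(4 * T) = T + -(5 * T) by ring, Real.exp_add]; ring
    _ ≤ Real.exp (3 * T) * Real.exp (-(4 * T)) := by gcongr
    _ = Real.exp (-T) := by rw [← Real.exp_add]; ring_nf

/-- The estimate behind the horizontal crossings: the number of strips is so large that it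
compensates for the probability, of order `exp (-L)`, that the bridges in one strip are open. -/
lemma horizontal_estimate {E L : ℕ} {T X p : ℝ} (hp : Real.exp (-(1 / 12)) ≤ p) (hp1 : p ≤ 1)
    (hE : Real.exp X ≤ E) (hX : 2 * (L : ℝ) ≤ X) (hXT : 8 * T ≤ Real.exp (X / 2)) (hX2 : 1 ≤ X) :
    (1 - p ^ (12 * L) / 2) ^ (E / 2) ≤ Real.exp (-T) := by
  have hp0 : 0 ≤ p := (Real.exp_pos _).le.trans hp
  have h1 : Real.exp (-(L : ℝ)) ≤ p ^ (12 * L) := by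
    refine le_trans (le_of_eq ?_) (pow_le_pow_left₀ (Real.exp_pos _).le hp _)
    rw [← Real.exp_nat_mul]
    push_cast
    ring_nf
  have h2 : p ^ (12 * L) ≤ 1 := pow_le_one₀ hp0 hp1
  have hE2 : (2 : ℝ) ≤ E := by linarith [Real.add_one_le_exp X]
  have hm : (E : ℝ) / 4 ≤ ((E / 2 : ℕ) : ℝ) := by
    have h3 : E ≤ 4 * (E / 2) := by
      have : 2 ≤ E := by exact_mod_cast hE2
      omega
    have h4 : (E : ℝ) ≤ 4 * ((E / 2 : ℕ) : ℝ) := by exact_mod_cast h3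
    linarith
  calc (1 - p ^ (12 * L) / 2) ^ (E / 2)
      ≤ (Real.exp (-(Real.exp (-(L : ℝ)) / 2))) ^ (E / 2) := by
        refine pow_le_pow_left₀ (by linarith) ?_ _
        linarith [Real.add_one_le_exp (-(Real.exp (-(L : ℝ)) / 2))]
    _ = Real.exp (-(((E / 2 : ℕ) : ℝ) * (Real.exp (-(L : ℝ)) / 2))) := by
        rw [← Real.exp_nat_mul]; ring_nf
    _ ≤ Real.exp (-T) := by
        refine Real.exp_le_exp.2 (neg_le_neg ?_)
        have h5 : Real.exp (X / 2) ≤ Real.exp X * Real.exp (-(L : ℝ)) := by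
          rw [← Real.exp_add]
          exact Real.exp_le_exp.2 (by linarith)
        have h6 : Real.exp X / 4 * (Real.exp (-(L : ℝ)) / 2) ≤
            ((E / 2 : ℕ) : ℝ) * (Real.exp (-(L : ℝ)) / 2) := by
          gcongr
          linarith
        linarith

lemma five_le_rpow_scale {A μ : ℝ} (hA : 9216 < A) (hμ1 : μ < 1) (k : ℕ) :
    5 ≤ (scale A (k + 1) : ℝ) ^ (1 - μ / ((k : ℝ) + 2)) := by
  have hA2 : 2 ≤ A := by linarith
  have hk : (0 : ℝ) ≤ k := Nat.cast_nonneg k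
  have hpow : A ^ 2 ≤ A ^ (k + 2) := pow_le_pow_right₀ (by linarith) (by omega)
  have hsc := hpow.trans (pow_le_scale hA2 k)
  refine le_trans ?_ (sqrt_le_rpow (by nlinarith) hμ1.le (by linarith))
  exact (by linarith : (5 : ℝ) ≤ A).trans (Real.le_sqrt_of_sq_le hsc)

theorem CrossingBound.succ {A β μ : ℝ} (hA : 9216 < A) (hμ0 : 0 < μ) (hμβ : μ < β) (hβ1 : β < 1)
    (hAμ : Real.log 96 ≤ μ / 2 * Real.log A) {k₀ k : ℕ} {p : I}
    (hp : Real.exp (-(1 / 12)) ≤ p) (hk : k₀ ≤ k + 1) (ih : CrossingBound A β μ k₀ (k + 1) p) :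
    CrossingBound A β μ k₀ (k + 2) p := by
  intro Λ i j hi
  have hA2 : 2 ≤ A := by linarith
  set L := scale A (k + 1) with hL
  set W := ⌊A ^ (k + 3)⌋₊ with hW
  set H := height A β (k + 1) with hH
  set X : ℝ := (scale A (k + 2) : ℝ) ^ (1 - β / ((k : ℝ) + 3)) with hX
  set E := ⌈Real.exp X⌉₊ with hE
  set Q : ℝ := (L : ℝ) ^ (1 - μ / ((k : ℝ) + 2)) with hQ
  set T : ℝ := (scale A (k + 2) : ℝ) ^ (1 - μ / ((k : ℝ) + 3)) with hT
  have hscale : scale A (k + 2) = W * L := rfl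
  have e3 : ((k + 1 : ℕ) : ℝ) + 2 = (k : ℝ) + 3 := by push_cast; ring
  have e2 : ((k + 1 : ℕ) : ℝ) + 1 = (k : ℝ) + 2 := by push_cast; ring
  have hheight : height A β (k + 2) = 2 * E * H := by
    rw [height, e3]
  have hTf : failBound A μ (k + 2) = Real.exp (-T) := by
    rw [failBound, hT]; push_cast; ring_nf
  have hQf : failBound A μ (k + 1) = Real.exp (-Q) := by
    rw [failBound, e2]
  have hW8 : 8 ≤ W := Nat.le_floor (by
    push_cast
    exact (by linarith : (8 : ℝ) ≤ A).trans (le_self_pow₀ (by linarith) (by omega)))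
  have hE1 : Real.exp X ≤ E := Nat.le_ceil _
  have hX0 : 0 ≤ X := by positivity
  have hE2 : (E : ℝ) ≤ 2 * Real.exp X := by
    have h1 := (Nat.ceil_lt_add_one (Real.exp_pos X).le).le
    have h2 := Real.one_le_exp hX0
    linarith
  have hgain : 48 * T ≤ W * Q := by
    have := rpow_scale_succ_le hA2 hμ0 (hμβ.trans hβ1) hAμ (k + 1)
    rwa [e3, e2] at this
  have hlog : 6 * Real.log (8 * W) ≤ Q := log_le_rpow_scale hA (hμβ.trans hβ1) k
  have hT5 : 5 ≤ T := by
    have := five_le_rpow_scale hA (hμβ.trans hβ1) (k + 1)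
    rwa [e3] at this
  have hX5 : 5 ≤ X := by
    have := five_le_rpow_scale hA hβ1 (k + 1)
    rwa [e3] at this
  have hXT : X ≤ T := by
    refine Real.rpow_le_rpow_of_exponent_le ?_ ?_
    · exact_mod_cast (two_le_scale hA2 (k + 2)).trans' one_le_two
    · gcongr
  have h2L : 2 * (L : ℝ) ≤ X := two_mul_scale_le hA (hμ0.trans hμβ) hβ1 k
  have h8T : 8 * T ≤ Real.exp (X / 2) := by
    have := eight_mul_rpow_scale_le_exp (β := β) hA hμ0 hβ1 (k + 1)
    rwa [e3] at this
  have hH0 : 0 < H := height_pos A β (k + 1)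
  rw [hTf]
  have ihV : ∀ a b, IsGood A k₀ Λ (k + 1) a →
      (law p Λ).real (blockV L H a b)ᶜ ≤ Real.exp (-Q) := fun a b ha => hQf ▸ (ih Λ a b ha).2
  have ihH : ∀ a b, IsGood A k₀ Λ (k + 1) a → IsGood A k₀ Λ (k + 1) (a + 1) →
      (law p Λ).real (blockH L H a b)ᶜ ≤ Real.exp (-Q) := fun a b ha ha' =>
    hQf ▸ (ih Λ a b ha).1 ha'
  have hgi := (isGood_succ_iff hk).1 hi
  constructor
  · intro hi'
    have hgi' := (isGood_succ_iff hk).1 hi'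
    rw [eventH, hscale, hheight,
      show i * (W * L) = (i * W) * L by ring, show (i + 2) * (W * L) = (i * W + 2 * W) * L by ring,
      show j * (2 * E * H) = (j * (2 * E)) * H by ring,
      show (j + 1) * (2 * E * H) = (j * (2 * E) + 2 * E) * H by ring]
    refine (law_compl_crossH_le p Λ (m := E / 2) (q := Real.exp (-Q))
      (good := IsGood A k₀ Λ (k + 1)) hH0 (by omega) (by omega) ?_ (Real.exp_pos _).le ?_
      (fun a b ha => ihV a b ha) (fun a b ha ha' => ihH a b ha ha')).trans
      (horizontal_estimate hp p.2.2 hE1 h2L h8T (by linarith))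
    · have hsplit : Finset.Ico (i * W) (i * W + 2 * W) =
          Finset.Ico (i * W) ((i + 1) * W) ∪ Finset.Ico ((i + 1) * W) ((i + 1 + 1) * W) := by
        have h1 : (i + 1) * W = i * W + W := by ring
        have h2 : (i + 1 + 1) * W = i * W + 2 * W := by ring
        rw [Finset.Ico_union_Ico_eq_Ico (by omega) (by omega), h2]
      rw [hsplit, Finset.filter_union]
      refine (Finset.card_union_le _ _).trans ?_
      exact Nat.add_le_add (card_filter_not_le_two hgi) (card_filter_not_le_two hgi')
    · have hW0 : (0 : ℝ) < W := by positivity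
      have hlog0 : 0 ≤ Real.log (8 * (W : ℝ)) := Real.log_nonneg (by
        have : (8 : ℝ) ≤ W := by exact_mod_cast hW8
        linarith)
      have h1 : 8 * (W : ℝ) ≤ Real.exp Q := by
        rw [← Real.log_le_iff_le_exp (by positivity)]
        linarith
      have h2 : Real.exp Q * Real.exp (-Q) = 1 := by rw [← Real.exp_add]; simp
      have h3 := mul_le_mul_of_nonneg_right h1 (Real.exp_pos (-Q)).le
      push_cast
      nlinarith
  · -- one of the two ends of the interval is a run of `2 n` good intervals
    set n := (W - 1) / 4 with hn
    obtain ⟨s, hs, hs', hrun⟩ := exists_run_of_not_separated (m := 2 * n)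
      (by have : (i + 1) * W = i * W + W := by ring
          change i * W + 2 * (2 * n) < (i + 1) * W
          omega) hgi
    have hEpos : 0 < E := Nat.ceil_pos.2 (Real.exp_pos _)
    have h1 : (j + 2) * (2 * E * H) = (j * (2 * E) + ((4 * E - 2) + 2)) * H := by
      rw [Nat.sub_add_cancel (by omega)]; ring
    rw [eventV, hscale, hheight, h1, show j * (2 * E * H) = (j * (2 * E)) * H by ring]
    refine (law_compl_crossV_le p Λ (L := L) (i₀ := s) (n := n) (r := 2 * Real.exp (-Q)) (by omega)
      ?_ ?_ ?_).trans (le_trans ?_ (vertical_estimate (n := n) (E := E) (W := W) (T := T) (Q := Q)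
        (by omega) (by omega) (by omega) hT5 hXT hE2 hgain hlog))
    · rw [← mul_assoc]
      exact Nat.mul_le_mul_right _ hs
    · rw [← mul_assoc]
      exact Nat.mul_le_mul_right _ hs'
    · intro a ha ha' b
      have g1 := hrun a ha (by omega)
      have g2 := hrun (a + 1) (by omega) ha'
      exact law_compl_inter_le p Λ (ihH a b g1 g2) (ihV a b g1)
    · refine mul_le_mul_of_nonneg_right ?_ (by positivity)
      have h2 : 2 * ((4 * E - 2) + 1) ≤ 8 * E := by omega
      exact_mod_cast h2

/-! ### The initial scale -/

/-- For a good interval, both crossings occur if all edges in a suitable row or column are open. -/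
lemma law_compl_event_le {A β : ℝ} (hA : 3 ≤ A) (p : I) {Λ : Set ℕ} {k₀ k i : ℕ} (j : ℕ)
    (hi : IsGood A k₀ Λ k i) :
    (law p Λ).real (eventH A β k i j)ᶜ ≤ 2 * (scale A k + height A β k) * (1 - (p : ℝ)) ∧
      (law p Λ).real (eventV A β k i j)ᶜ ≤ 2 * (scale A k + height A β k) * (1 - (p : ℝ)) := by
  have hp : 0 ≤ 1 - (p : ℝ) := by linarith [p.2.2]
  have hH := height_pos A β k
  set L := scale A k
  set H := height A β k
  have hcast : (2 * ((L : ℝ) + H)) = ((2 * (L + H) : ℕ) : ℝ) := by push_cast; ring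
  rw [hcast]
  constructor
  · let S : Finset Edge := (Finset.Ico (i * L) ((i + 2) * L)).image fun t => ((t, j * H), true)
    have hcard : S.card ≤ 2 * (L + H) := by
      refine Finset.card_image_le.trans ?_
      rw [Nat.card_Ico, ← Nat.sub_mul, Nat.add_sub_cancel_left]
      omega
    have hsub : (eventH A β k i j)ᶜ ⊆ {ω | ∀ e ∈ S, ω e = true}ᶜ := by
      refine compl_subset_compl.2 fun ω hω => ?_
      have hjH : j * H < (j + 1) * H := Nat.mul_lt_mul_of_pos_right (by omega) hH
      refine ⟨j * H, ⟨le_rfl, hjH.le⟩, j * H, ⟨le_rfl, hjH.le⟩,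
        reachable_of_row_open le_rfl (Nat.mul_le_mul_right _ (by omega)) le_rfl ⟨le_rfl, hjH⟩ ?_⟩
      exact fun t ht => hω _ (Finset.mem_image.2 ⟨t, Finset.mem_Ico.2 ht, rfl⟩)
    refine (measureReal_mono hsub (measure_ne_top _ _)).trans
      ((law_exists_closed_le p Λ ?_).trans (mul_le_mul_of_nonneg_right (by exact_mod_cast hcard) hp))
    intro e he
    obtain ⟨t, -, rfl⟩ := Finset.mem_image.1 he
    simp [edgeProb]
  · obtain ⟨x, hxΛ, hx⟩ := hi.nonempty hA
    let S : Finset Edge := (Finset.Ico (j * H) ((j + 2) * H)).image fun t => ((x, t), false)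
    have hcard : S.card ≤ 2 * (L + H) := by
      refine Finset.card_image_le.trans ?_
      rw [Nat.card_Ico, ← Nat.sub_mul, Nat.add_sub_cancel_left]
      omega
    have hsub : (eventV A β k i j)ᶜ ⊆ {ω | ∀ e ∈ S, ω e = true}ᶜ := by
      refine compl_subset_compl.2 fun ω hω => ?_
      refine ⟨x, ⟨hx.1, hx.2.le⟩, x, ⟨hx.1, hx.2.le⟩,
        reachable_of_column_open le_rfl (Nat.mul_le_mul_right _ (by omega)) le_rfl hx ?_⟩
      exact fun t ht => hω _ (Finset.mem_image.2 ⟨t, Finset.mem_Ico.2 ht, rfl⟩)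
    refine (measureReal_mono hsub (measure_ne_top _ _)).trans
      ((law_exists_closed_le p Λ ?_).trans (mul_le_mul_of_nonneg_right (by exact_mod_cast hcard) hp))
    intro e he
    obtain ⟨t, -, rfl⟩ := Finset.mem_image.1 he
    simp [edgeProb, hxΛ]

/-- Near `p = 1` the crossing bound holds at any given scale. -/
lemma exists_crossingBound {A : ℝ} (hA : 3 ≤ A) (β μ : ℝ) (k₀ k : ℕ) :
    ∃ p₀ : I, p₀ < 1 ∧ Real.exp (-(1 / 12)) ≤ p₀ ∧
      ∀ p : I, p₀ ≤ p → CrossingBound A β μ k₀ k p := by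
  set N : ℝ := 2 * (scale A k + height A β k) with hN
  have hN0 : 0 < N := by
    have : (0 : ℝ) < height A β k := by exact_mod_cast height_pos A β k
    positivity
  have hb : 0 < failBound A μ k := Real.exp_pos _
  have h1 : Real.exp (-(1 / 12 : ℝ)) < 1 := Real.exp_lt_one_iff.2 (by norm_num)
  have h2 : 1 - failBound A μ k / N < 1 := by
    have : 0 < failBound A μ k / N := div_pos hb hN0
    linarith
  refine ⟨⟨max (Real.exp (-(1 / 12))) (1 - failBound A μ k / N),
    (Real.exp_pos _).le.trans (le_max_left _ _), (max_lt h1 h2).le⟩, ?_, le_max_left _ _, ?_⟩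
  · exact Subtype.coe_lt_coe.1 (max_lt h1 h2)
  · intro p hp Λ i j hi
    have h3 : 1 - failBound A μ k / N ≤ (p : ℝ) := (le_max_right _ _).trans (Subtype.coe_le_coe.2 hp)
    have h4 : N * (1 - (p : ℝ)) ≤ failBound A μ k := by
      have : 1 - (p : ℝ) ≤ failBound A μ k / N := by linarith
      rw [le_div_iff₀ hN0] at this
      linarith
    have h5 := law_compl_event_le (β := β) hA p j hi
    exact ⟨fun _ => h5.1.trans h4, h5.2.trans h4⟩

lemma CrossingBound.qProb_le {A β μ : ℝ} {k₀ k : ℕ} {p : I} (h : CrossingBound A β μ k₀ k p)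
    (i j : ℕ) : qProb A β k₀ k i j p ≤ ENNReal.ofReal (failBound A μ k) := by
  refine max_le (iSup₂_le fun Λ hΛ => ?_) (iSup₂_le fun Λ hΛ => ?_)
  · exact (ENNReal.le_ofReal_iff_toReal_le (measure_ne_top _ _) (Real.exp_pos _).le).2
      ((h Λ i j hΛ.1).1 hΛ.2)
  · exact (ENNReal.le_ofReal_iff_toReal_le (measure_ne_top _ _) (Real.exp_pos _).le).2
      (h Λ i j hΛ).2

/-! ### Thresholds -/

lemma exists_isThreshold {c₀ : ℝ} (hc₀ : 8 * Real.sqrt (Real.log 96) < c₀) :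
    ∃ α₀ μ₀ : ℝ, IsThreshold c₀ α₀ μ₀ := by
  have hl : 0 < Real.log 96 := Real.log_pos (by norm_num)
  have hc0 : 0 < c₀ := lt_of_le_of_lt (by positivity) hc₀
  have hsq : 2 * Real.log 96 < c₀ ^ 2 / 32 := by
    have h1 : (8 * Real.sqrt (Real.log 96)) ^ 2 < c₀ ^ 2 := by gcongr
    rw [mul_pow, Real.sq_sqrt hl.le] at h1
    linarith
  -- With `c₀² / 32 = 2 log 96 + 2 g`, take `log α₀ = -g` and `μ₀ = 2 log 96 / (2 log 96 + g)`.
  set g := (c₀ ^ 2 / 32 - 2 * Real.log 96) / 2 with hg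
  have hg0 : 0 < g := by linarith
  refine ⟨Real.exp (-g), 2 * Real.log 96 / (2 * Real.log 96 + g), ?_, ?_, by positivity, ?_, ?_⟩
  · exact Real.exp_lt_exp.2 (by linarith)
  · exact Real.exp_lt_one_iff.2 (by linarith)
  · rw [div_lt_one (by positivity)]
    linarith
  · intro α μ c hα _ hμ _ hc
    have hα0 : 0 < α := (Real.exp_pos _).trans hα
    have hgr : 0 < growth α c := mul_pos hα0 (Real.exp_pos _)
    have hμ0 : 0 < μ := lt_trans (by positivity) hμ
    rw [← Real.log_lt_log_iff (by norm_num) (Real.rpow_pos_of_pos hgr _), Real.log_rpow hgr,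
      growth, Real.log_mul hα0.ne' (Real.exp_pos _).ne', Real.log_exp]
    have h1 : -g < Real.log α := (Real.lt_log_iff_exp_lt hα0).2 hα
    have h2 : c₀ ^ 2 ≤ c ^ 2 := by gcongr
    have h3 : 2 * Real.log 96 + g < Real.log α + c ^ 2 / 32 := by linarith
    rw [div_lt_iff₀ (by positivity)] at hμ
    nlinarith

lemma IsThreshold.growth_gt {c₀ α₀ μ₀ α μ c : ℝ} (h : IsThreshold c₀ α₀ μ₀) (hα : α₀ < α)
    (hα1 : α < 1) (hμ : μ₀ < μ) (hμ1 : μ < 1) (hc : c₀ ≤ c) :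
    9216 < growth α c ∧ Real.log 96 ≤ μ / 2 * Real.log (growth α c) := by
  obtain ⟨h1, -, h3, -, h5⟩ := h
  have hgr : 0 < growth α c := mul_pos (((Real.exp_pos _).trans h1).trans hα) (Real.exp_pos _)
  have h6 := (Real.log_lt_log_iff (by norm_num) (Real.rpow_pos_of_pos hgr _)).2
    (h5 α μ c hα hα1 hμ hμ1 hc)
  rw [Real.log_rpow hgr] at h6
  refine ⟨?_, h6.le⟩
  have hl : 0 < Real.log 96 := Real.log_pos (by norm_num)
  rw [show (9216 : ℝ) = 96 ^ 2 by norm_num, ← Real.log_lt_log_iff (by norm_num) hgr, Real.log_pow]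
  push_cast
  nlinarith

end

end Stretched

theorem mainTheorem3 (c₀ : ℝ) (hc₀ : 8 * Real.sqrt (Real.log 96) < c₀) :
    (∃ α₀ μ₀ : ℝ, Stretched.IsThreshold c₀ α₀ μ₀) ∧
    ∀ α₀ μ₀ : ℝ, Stretched.IsThreshold c₀ α₀ μ₀ →
    ∀ α β μ : ℝ, α₀ < α → α < 1 → μ₀ < μ → μ < β → β < 1 →
    ∀ k₀ : ℕ, ∃ k₃ : ℕ, k₀ ≤ k₃ ∧
    ∀ c : ℝ, c₀ ≤ c → ∃ p₀ : unitInterval, p₀ < 1 ∧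
    ∀ k : ℕ, k₃ ≤ k → ∀ p : unitInterval, p₀ ≤ p → ∀ i j : ℕ,
      Stretched.qProb (Stretched.growth α c) β k₀ k i j p ≤
        ENNReal.ofReal (Real.exp
          (-((Stretched.scale (Stretched.growth α c) k : ℝ) ^ (1 - μ / ((k : ℝ) + 1))))) := by
  refine ⟨Stretched.exists_isThreshold hc₀, ?_⟩
  intro α₀ μ₀ hth α β μ hα hα1 hμ hμβ hβ1 k₀
  refine ⟨k₀ + 1, by omega, fun c hc => ?_⟩
  obtain ⟨hA, hAμ⟩ := hth.growth_gt hα hα1 hμ (hμβ.trans hβ1) hc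
  have hμ0 : 0 < μ := hth.2.2.1.trans hμ
  obtain ⟨p₀, hp₀, hpe, hbase⟩ :=
    Stretched.exists_crossingBound (by linarith : 3 ≤ Stretched.growth α c) β μ k₀ (k₀ + 1)
  refine ⟨p₀, hp₀, fun k hk p hp i j => Stretched.CrossingBound.qProb_le ?_ i j⟩
  induction k, hk using Nat.le_induction with
  | base => exact hbase p hp
  | succ k hk ih =>
    obtain ⟨l, rfl⟩ := Nat.exists_eq_add_of_le' (by omega : 1 ≤ k)
    exact ih.succ hA hμ0 hμβ hβ1 hAμ (hpe.trans (Subtype.coe_le_coe.2 hp)) (by omega)
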